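/- Let $(\Omega,\mathcal F,P)$ be a probability space, let $1<\zeta\le 2$ and $\varphi(t)=|t|^\zeta/\zeta$, $t\in\mathbb R$. A random variable $\xi$ belongs to $\mathrm{Sub}_\varphi(\Omega)$ if there is $a\ge 0$ such that $E\exp(\lambda\xi)\le\exp(\varphi(a\lambda))$ for all $\lambda\in\mathbb R$; $\tau_\varphi(\xi)$ denotes the infimum of all such $a$. Let $(B,\rho)$ be a compact metric space with at least two points, and let $N_B(u)$ be the least number of closed balls of radius $u$ that cover $B$. Let $X=\{X(t),t\in B\}$ be a separable process with $X(t)\in\mathrm{Sub}_\varphi(\Omega)$ for all $t$, and suppose that $$X(t)=\sum_{k=1}^\infty a_k(t)\,\xi_k$$ in mean square for every $t\in B$, where $\xi_k\in\mathrm{Sub}_\varphi(\Omega)$ are independent and $a_k:B\to\mathbb R$. Suppose that there is a continuous strictly increasing function $\sigma(h)$, $h>0$, with $\sigma(h)\to0$ as $h\to0$ and $\sup_{\rho(t,s)\le h}\tau_\varphi(X(t)-X(s))\le\sigma(h)$ for all $h>0$. Let $\hat a_k:B\to\mathbb R$ be approximations of $a_k$, $\delta_k(t)=|a_k(t)-\hat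 a_k(t)|$, let $X_N(t)=\sum_{k=1}^N\hat a_k(t)\xi_k$ be the model of $X$, and let $\Delta_N(t)=X(t)-X_N(t)$. Let $\sigma_N(h)$, $h>0$, be a continuous strictly increasing function with $\sigma_N(h)\to0$ as $h\to0$ and $$\sup_{\rho(t,s)\le h}\tau_\varphi(\Delta_N(t)-\Delta_N(s))\le\sigma_N(h)\quad\text{for all } h>0,$$ and put $\beta=\sigma_N\bigl(\inf_{s\in B}\sup_{t\in B}\rho(t,s)\bigr)$. Let $r:[1,\infty)\to\mathbb R$ be continuous and strictly increasing, with $r(u)>0$ for $u>1$ and $t\mapsto r(e^t)$ convex on $t>0$, and suppose that $$\int_0^\beta r\bigl(N_B(\sigma_N^{(-1)}(u))\bigr)\,du<\infty .$$ Put $\gamma_N=\sup_{u\in B}\tau_\varphi(\Delta_N(u))$. Then $\gamma_N<\infty$ and $$\gamma_N^\zeta\le\sum_{k=1}^N\tau_\varphi^\zeta(\xi_k)\sup_{u\in B}\delta_k^\zeta(u)+\sum_{k=N+1}^\infty\tau_\varphi^\zeta(\xi_k)\sup_{u\in B}|a_k(u)|^\zeta$$ (the right-hand side may be $+\infty$;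 $0\cdot\infty=0$). Moreover, for all $p\in(0,1)$, $\delta>0$ and all $\nu$ with $$\nu\ \ge\ 2\exp\left\{-\frac{(\zeta-1)\,(\delta(1-p))^{\frac{\zeta}{\zeta-1}}}{\zeta\,\bigl(\gamma_N^\zeta(1-p)+p\beta^\zeta\bigr)^{\frac1{\zeta-1}}}\right\}\; r^{(-1)}\!\left(\frac1{\beta p}\int_0^{\beta p} r\bigl(N_B(\sigma_N^{(-1)}(u))\bigr)\,du\right),$$ the model $X_N$ approximates $X$ with reliability $1-\nu$ and accuracy $\delta$ in $C(B)$, that is, $$P\Bigl\{\sup_{t\in B}|X(t)-X_N(t)|>\delta\Bigr\}\le\nu .$$ Here $\sigma_N^{(-1)}$ and $r^{(-1)}$ are the inverse functions. -/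

import Mathlib

open MeasureTheory ProbabilityTheory Filter Topology Set

noncomputable section

/-- The function `φ(t) = |t|^ζ / ζ` (even extension of `t^ζ / ζ`). For `1 < ζ ≤ 2` these are the
members of the class `C_II`. -/
def phiPow (ζ : ℝ) (t : ℝ) : ℝ := |t| ^ ζ / ζ

/-- `E exp(l ξ) ≤ exp(φ(a l))` for all real `l`. The expectation is a Lebesgue integral with values
in `[0, ∞]`, so the inequality contains the finiteness of the exponential moments. -/
def ExpBound {Ω : Type*} [MeasurableSpace Ω] (φ : ℝ → ℝ) (P : Measure Ω) (ξ : Ω → ℝ) (a : ℝ) :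
    Prop :=
  ∀ l : ℝ, ∫⁻ ω, ENNReal.ofReal (Real.exp (l * ξ ω)) ∂P ≤ ENNReal.ofReal (Real.exp (φ (a * l)))

/-- `ξ` is a `φ`-sub-Gaussian random variable, `ξ ∈ Sub_φ(Ω)`. -/
def IsPhiSubGaussian {Ω : Type*} [MeasurableSpace Ω] (φ : ℝ → ℝ) (P : Measure Ω) (ξ : Ω → ℝ) :
    Prop :=
  Measurable ξ ∧ ∃ a : ℝ, 0 ≤ a ∧ ExpBound φ P ξ a

/-- The `φ`-sub-Gaussian standard `τ_φ(ξ)` of a random variable. -/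
def tauPhi {Ω : Type*} [MeasurableSpace Ω] (φ : ℝ → ℝ) (P : Measure Ω) (ξ : Ω → ℝ) : ℝ :=
  sInf {a : ℝ | 0 ≤ a ∧ ExpBound φ P ξ a}

/-- Separability of a real process on `B` (in the sense of Doob): for some countable dense `S` and
outside one null event, for every open `U` and closed `F`, if all values at points of `U ∩ S` lie
in `F`, then so do all values at points of `U`. -/
def IsSeparableProcess {Ω B : Type*} [MeasurableSpace Ω] [TopologicalSpace B] (P : Measure Ω)
    (X : B → Ω → ℝ) : Prop :=
  ∃ S : Set B, S.Countable ∧ Dense S ∧ ∀ᵐ ω ∂P, ∀ U : Set B, IsOpen U → ∀ F : Set ℝ, IsClosed F →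
    (∀ s ∈ U ∩ S, X s ω ∈ F) → ∀ t ∈ U, X t ω ∈ F

/-- `σ = {σ(h), h > 0}` is continuous, increasing, and `σ(h) → 0` as `h → 0`. -/
def IsModulus (σ : ℝ → ℝ) : Prop :=
  ContinuousOn σ (Ioi 0) ∧ StrictMonoOn σ (Ioi 0) ∧ Tendsto σ (𝓝[>] 0) (𝓝 0)

/-- `sup_{ρ(t,s) ≤ h} τ_φ(Y(t) - Y(s)) ≤ σ(h)` for all `h > 0`. -/
def IncrementsBoundedBy {Ω B : Type*} [MeasurableSpace Ω] [MetricSpace B] (φ : ℝ → ℝ)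
    (P : Measure Ω) (Y : B → Ω → ℝ) (σ : ℝ → ℝ) : Prop :=
  ∀ h : ℝ, 0 < h → ∀ t s : B, dist t s ≤ h → tauPhi φ P (fun ω => Y t ω - Y s ω) ≤ σ h

/-- The conditions on the function `r = {r(u), u ≥ 1}`: continuous, increasing, positive for
`u > 1`, and `t ↦ r(exp t)` is convex for `t > 0`. -/
def IsEntropyGauge (r : ℝ → ℝ) : Prop :=
  ContinuousOn r (Ici 1) ∧ StrictMonoOn r (Ici 1) ∧ (∀ u, 1 < u → 0 < r u) ∧
    ConvexOn ℝ (Ioi 0) (fun t => r (Real.exp t))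

/-- Metric massiveness `N_B(u)`: the least number of closed balls of radius `u` covering `B`. -/
def massiveness (B : Type*) [MetricSpace B] (u : ℝ) : ℕ :=
  (Metric.coveringNumber u.toNNReal (univ : Set B)).toNat

/-- `inf_{s ∈ B} sup_{t ∈ B} ρ(t, s)`. -/
def chebyshevRadius (B : Type*) [MetricSpace B] : ℝ := ⨅ s : B, ⨆ t : B, dist t s

/-- The function `σ^{(-1)}`, inverse of `σ` on `(0, ∞)`. -/
def modulusInv (σ : ℝ → ℝ) : ℝ → ℝ := Function.invFunOn σ (Ioi 0)

/-- The function `r^{(-1)}`, inverse of `r` on `[1, ∞)`. -/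
def gaugeInv (r : ℝ → ℝ) : ℝ → ℝ := Function.invFunOn r (Ici 1)

/-- The integrand `u ↦ r(N_B(σ^{(-1)}(u)))`. -/
def entropyIntegrand (B : Type*) [MetricSpace B] (r σ : ℝ → ℝ) (u : ℝ) : ℝ :=
  r (massiveness B (modulusInv σ u))

/-- For every `t` the series `∑ ξ_k a_k(t)` converges to `X(t)` in mean square. The terms are
numbered from `0`. -/
def IsMeanSquareSeries {Ω B : Type*} [MeasurableSpace Ω] (P : Measure Ω) (X : B → Ω → ℝ)
    (ξ : ℕ → Ω → ℝ) (a : ℕ → B → ℝ) : Prop :=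
  ∀ t : B, Tendsto
    (fun n : ℕ => eLpNorm (fun ω => X t ω - ∑ k ∈ Finset.range n, ξ k ω * a k t) 2 P) atTop (𝓝 0)

/-- The model: the sum of the first `N` terms, with approximations `b k` of the coefficient
functions. -/
def model {Ω B : Type*} (ξ : ℕ → Ω → ℝ) (b : ℕ → B → ℝ) (N : ℕ) (t : B) (ω : Ω) : ℝ :=
  ∑ k ∈ Finset.range N, ξ k ω * b k t

/-- `Y` approximates `X` in `C(B)` with reliability `1 - ν` and accuracy `δ`:
`P{sup_t |X(t) - Y(t)| > δ} ≤ ν`. -/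
def ApproximatesWith {Ω B : Type*} [MeasurableSpace Ω] (P : Measure Ω) (X Y : B → Ω → ℝ)
    (ν δ : ℝ) : Prop :=
  P {ω | ENNReal.ofReal δ < ⨆ t : B, ENNReal.ofReal |X t ω - Y t ω|} ≤ ENNReal.ofReal ν

end

/-! The tail bound is a chaining argument. Write `Y` for the error process and take minimal nets `V
k` of radius `σ⁻¹(β p^(k+1))`. Walking from a point of `V m` down through the coarser nets bounds
`|Y|` by a sum of maxima of links: the link on `V 0` is `Y` itself, with standard at most `γ`, and
the link from `V (k+1)` to `V k` has standard at most `β p^(k+1)`. Hölder's inequality with weights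
`(1-p) p^k` multiplies the argument of the `k`-th link by `p^(-k)`, which cancels the decay of its
standard, so `E exp(x(1-p) max_{V m} |Y|)` is at most `2 exp(∑ w_k log |V k|) exp((γ^ζ(1-p) + pβ^ζ)
x^ζ/ζ)` (`lintegral_exp_sup_le_of_chain`). Jensen's inequality for `r ∘ exp` and comparison of a
geometric sum with an integral turn the entropy factor into `r⁻¹` of the mean of the integrand
(`IsEntropyGauge.map_exp_sum_log_le`, `AntitoneOn.sum_geometric_le_integral`). Fatou, Markov and the
optimal `x` finish the bound on a countable set (`measure_exists_abs_gt_le_entropy`).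

Passing to all of `B` needs almost surely continuous paths of the model. Its increments are
controlled by `σ + σN`, and independence of centred terms passes this control to each coefficient
(`abs_mul_tauPhi_le`, `ae_continuous_model`).

The estimate of `γ` holds because exponential moments of independent terms multiply, so `τ^ζ` is
subadditive over the series, and Fatou reaches the mean-square limit (`ofReal_tauPhi_rpow_le_tsum`).
-/

/-! ### Calculus of `φ`-sub-Gaussian variables and their standard. -/

section SubGaussian

variable {Ω : Type*} [MeasurableSpace Ω] {P : Measure Ω} {ζ : ℝ} {ξ η : Ω → ℝ} {a b c : ℝ}

lemma phiPow_mono (hζ : 0 < ζ) (ha : 0 ≤ a) (hab : a ≤ b) (l : ℝ) :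
    phiPow ζ (a * l) ≤ phiPow ζ (b * l) := by
  unfold phiPow
  rw [abs_mul, abs_mul, abs_of_nonneg ha, abs_of_nonneg (ha.trans hab)]
  gcongr

lemma continuous_phiPow (hζ : 0 < ζ) : Continuous (phiPow ζ) := by
  unfold phiPow
  exact (continuous_abs.rpow_const fun _ => Or.inr hζ.le).div_const _

lemma phiPow_neg (t : ℝ) : phiPow ζ (-t) = phiPow ζ t := by
  simp [phiPow]

lemma phiPow_zero (hζ : 0 < ζ) : phiPow ζ 0 = 0 := by
  simp [phiPow, Real.zero_rpow hζ.ne']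

lemma ExpBound.mono (hζ : 0 < ζ) (h : ExpBound (phiPow ζ) P ξ a) (ha : 0 ≤ a) (hab : a ≤ b) :
    ExpBound (phiPow ζ) P ξ b := fun l =>
  (h l).trans (ENNReal.ofReal_le_ofReal (Real.exp_le_exp.2 (phiPow_mono hζ ha hab l)))

/-- Continuity of the bound in its constant: this makes the infimum in `tauPhi` attained and removes
strict positivity assumptions on constants. -/
lemma ExpBound.of_forall_gt (hζ : 0 < ζ) (h : ∀ b, a < b → ExpBound (phiPow ζ) P ξ b) :
    ExpBound (phiPow ζ) P ξ a := by
  intro l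
  have hc : Continuous fun b : ℝ => ENNReal.ofReal (Real.exp (phiPow ζ (b * l))) :=
    ENNReal.continuous_ofReal.comp
      (Real.continuous_exp.comp ((continuous_phiPow hζ).comp (continuous_id.mul continuous_const)))
  have ht : Tendsto (fun b : ℝ => ENNReal.ofReal (Real.exp (phiPow ζ (b * l)))) (𝓝[>] a)
      (𝓝 (ENNReal.ofReal (Real.exp (phiPow ζ (a * l))))) :=
    (hc.tendsto a).mono_left nhdsWithin_le_nhds
  exact ge_of_tendsto ht (by filter_upwards [self_mem_nhdsWithin] with b hb using h b hb l)

lemma tauPhi_nonneg (φ : ℝ → ℝ) (P : Measure Ω) (ξ : Ω → ℝ) : 0 ≤ tauPhi φ P ξ :=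
  Real.sInf_nonneg fun _ h => h.1

lemma tauPhi_le {φ : ℝ → ℝ} (ha : 0 ≤ a) (h : ExpBound φ P ξ a) : tauPhi φ P ξ ≤ a :=
  csInf_le ⟨0, fun _ h => h.1⟩ ⟨ha, h⟩

lemma IsPhiSubGaussian.expBound_tauPhi (hζ : 0 < ζ) (h : IsPhiSubGaussian (phiPow ζ) P ξ) :
    ExpBound (phiPow ζ) P ξ (tauPhi (phiPow ζ) P ξ) := by
  refine ExpBound.of_forall_gt hζ fun b hb => ?_
  obtain ⟨c, hc, hcb⟩ := exists_lt_of_csInf_lt (by obtain ⟨a, ha⟩ := h.2; exact ⟨a, ha⟩) hb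
  exact hc.2.mono hζ hc.1 hcb.le

lemma IsPhiSubGaussian.expBound (hζ : 0 < ζ) (h : IsPhiSubGaussian (phiPow ζ) P ξ)
    (ha : tauPhi (phiPow ζ) P ξ ≤ a) : ExpBound (phiPow ζ) P ξ a :=
  (h.expBound_tauPhi hζ).mono hζ (tauPhi_nonneg _ _ _) ha

lemma ExpBound.const_mul (h : ExpBound (phiPow ζ) P ξ a) (c : ℝ) :
    ExpBound (phiPow ζ) P (fun ω => ξ ω * c) (|c| * a) := by
  intro l
  refine le_trans (le_of_eq ?_) ((h (l * c)).trans (le_of_eq ?_))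
  · refine lintegral_congr fun ω => ?_
    ring_nf
  · simp only [phiPow, abs_mul, abs_abs]
    ring_nf

lemma expBound_zero [IsProbabilityMeasure P] (hζ : 0 < ζ) :
    ExpBound (phiPow ζ) P (fun _ => (0 : ℝ)) 0 := by
  intro l
  simp [phiPow_zero hζ]

lemma ExpBound.add_of_pos (hξ : Measurable ξ) (ha : 0 < a) (hb : 0 < b)
    (h₁ : ExpBound (phiPow ζ) P ξ a) (h₂ : ExpBound (phiPow ζ) P η b) :
    ExpBound (phiPow ζ) P (fun ω => ξ ω + η ω) (a + b) := by
  intro l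
  have hab : 0 < a + b := add_pos ha hb
  -- These convexity weights make both rescaled bounds equal to the one with constant `a + b`.
  set u := a / (a + b) with hu
  set v := b / (a + b) with hv
  have hu0 : 0 < u := div_pos ha hab
  have hv0 : 0 < v := div_pos hb hab
  have huv : u + v = 1 := by rw [hu, hv]; field_simp
  have hau : a * (l / u) = (a + b) * l := by rw [hu]; field_simp
  have hbv : b * (l / v) = (a + b) * l := by rw [hv]; field_simp
  have key : ∀ ω, ENNReal.ofReal (Real.exp (l * (ξ ω + η ω))) ≤
      ENNReal.ofReal u * ENNReal.ofReal (Real.exp (l / u * ξ ω)) +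
        ENNReal.ofReal v * ENNReal.ofReal (Real.exp (l / v * η ω)) := by
    intro ω
    rw [← ENNReal.ofReal_mul hu0.le, ← ENNReal.ofReal_mul hv0.le,
      ← ENNReal.ofReal_add (by positivity) (by positivity)]
    refine ENNReal.ofReal_le_ofReal ?_
    have := convexOn_exp.2 (mem_univ (l / u * ξ ω)) (mem_univ (l / v * η ω)) hu0.le hv0.le huv
    simp only [smul_eq_mul] at this
    refine le_trans (le_of_eq ?_) this
    congr 1
    field_simp
  have hm : Measurable fun ω => ENNReal.ofReal u * ENNReal.ofReal (Real.exp (l / u * ξ ω)) := by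
    fun_prop
  calc ∫⁻ ω, ENNReal.ofReal (Real.exp (l * (ξ ω + η ω))) ∂P
      ≤ ∫⁻ ω, (ENNReal.ofReal u * ENNReal.ofReal (Real.exp (l / u * ξ ω)) +
        ENNReal.ofReal v * ENNReal.ofReal (Real.exp (l / v * η ω))) ∂P := lintegral_mono key
    _ = ENNReal.ofReal u * ∫⁻ ω, ENNReal.ofReal (Real.exp (l / u * ξ ω)) ∂P +
        ENNReal.ofReal v * ∫⁻ ω, ENNReal.ofReal (Real.exp (l / v * η ω)) ∂P := by
      rw [lintegral_add_left hm, lintegral_const_mul' _ _ ENNReal.ofReal_ne_top,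
        lintegral_const_mul' _ _ ENNReal.ofReal_ne_top]
    _ ≤ ENNReal.ofReal u * ENNReal.ofReal (Real.exp (phiPow ζ ((a + b) * l))) +
        ENNReal.ofReal v * ENNReal.ofReal (Real.exp (phiPow ζ ((a + b) * l))) := by
      gcongr
      · rw [← hau]; exact h₁ _
      · rw [← hbv]; exact h₂ _
    _ = ENNReal.ofReal (Real.exp (phiPow ζ ((a + b) * l))) := by
      rw [← add_mul, ← ENNReal.ofReal_add hu0.le hv0.le, huv, ENNReal.ofReal_one, one_mul]

lemma ExpBound.add (hζ : 0 < ζ) (hξ : Measurable ξ) (ha : 0 ≤ a) (hb : 0 ≤ b)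
    (h₁ : ExpBound (phiPow ζ) P ξ a) (h₂ : ExpBound (phiPow ζ) P η b) :
    ExpBound (phiPow ζ) P (fun ω => ξ ω + η ω) (a + b) := by
  refine ExpBound.of_forall_gt hζ fun c hc => ?_
  have hd : 0 < (c - (a + b)) / 2 := by linarith
  have := ExpBound.add_of_pos hξ (a := a + (c - (a + b)) / 2) (b := b + (c - (a + b)) / 2)
    (by linarith) (by linarith) (h₁.mono hζ ha (by linarith)) (h₂.mono hζ hb (by linarith))
  convert this using 1
  ring

lemma ExpBound.sub (hζ : 0 < ζ) (hξ : Measurable ξ) (ha : 0 ≤ a) (hb : 0 ≤ b)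
    (h₁ : ExpBound (phiPow ζ) P ξ a) (h₂ : ExpBound (phiPow ζ) P η b) :
    ExpBound (phiPow ζ) P (fun ω => ξ ω - η ω) (a + b) := by
  have := h₁.add hζ hξ ha (b := b) hb (η := fun ω => η ω * (-1)) (by simpa using h₂.const_mul (-1))
  simpa [sub_eq_add_neg] using this

lemma IsPhiSubGaussian.sub (hζ : 0 < ζ) (h₁ : IsPhiSubGaussian (phiPow ζ) P ξ)
    (h₂ : IsPhiSubGaussian (phiPow ζ) P η) :
    IsPhiSubGaussian (phiPow ζ) P (fun ω => ξ ω - η ω) := by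
  obtain ⟨m₁, a, ha, h₁⟩ := h₁
  obtain ⟨m₂, b, hb, h₂⟩ := h₂
  exact ⟨m₁.sub m₂, a + b, add_nonneg ha hb, h₁.sub hζ m₁ ha hb h₂⟩

lemma IsPhiSubGaussian.const_mul (h : IsPhiSubGaussian (phiPow ζ) P ξ) (c : ℝ) :
    IsPhiSubGaussian (phiPow ζ) P (fun ω => ξ ω * c) := by
  obtain ⟨m, a, ha, h⟩ := h
  exact ⟨m.mul_const c, |c| * a, by positivity, h.const_mul c⟩

lemma IsPhiSubGaussian.sum [IsProbabilityMeasure P] (hζ : 0 < ζ) {ι : Type*} (s : Finset ι)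
    {f : ι → Ω → ℝ} (h : ∀ i, IsPhiSubGaussian (phiPow ζ) P (f i)) :
    IsPhiSubGaussian (phiPow ζ) P (fun ω => ∑ i ∈ s, f i ω) := by
  classical
  induction s using Finset.induction_on with
  | empty => exact ⟨by simp, 0, le_rfl, by simpa using expBound_zero hζ⟩
  | insert i s hi ih =>
    obtain ⟨m₁, a, ha, h₁⟩ := h i
    obtain ⟨m₂, b, hb, h₂⟩ := ih
    simp_rw [Finset.sum_insert hi]
    exact ⟨m₁.add m₂, a + b, add_nonneg ha hb, h₁.add hζ m₁ ha hb h₂⟩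

lemma tauPhi_sub_le (hζ : 0 < ζ) (h₁ : IsPhiSubGaussian (phiPow ζ) P ξ)
    (h₂ : IsPhiSubGaussian (phiPow ζ) P η) :
    tauPhi (phiPow ζ) P (fun ω => ξ ω - η ω) ≤ tauPhi (phiPow ζ) P ξ + tauPhi (phiPow ζ) P η :=
  tauPhi_le (add_nonneg (tauPhi_nonneg _ _ _) (tauPhi_nonneg _ _ _))
    ((h₁.expBound_tauPhi hζ).sub hζ h₁.1 (tauPhi_nonneg _ _ _) (tauPhi_nonneg _ _ _)
      (h₂.expBound_tauPhi hζ))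

lemma ExpBound.lintegral_exp_abs_le (hξ : Measurable ξ) (h : ExpBound (phiPow ζ) P ξ a) (l : ℝ) :
    ∫⁻ ω, ENNReal.ofReal (Real.exp (l * |ξ ω|)) ∂P ≤
      2 * ENNReal.ofReal (Real.exp (phiPow ζ (a * l))) := by
  have key : ∀ ω, ENNReal.ofReal (Real.exp (l * |ξ ω|)) ≤
      ENNReal.ofReal (Real.exp (l * ξ ω)) + ENNReal.ofReal (Real.exp (-l * ξ ω)) := by
    intro ω
    rcases abs_cases (ξ ω) with ⟨h, _⟩ | ⟨h, _⟩ <;> rw [h]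
    · exact le_self_add
    · rw [mul_neg, ← neg_mul]
      exact le_add_self
  refine (lintegral_mono key).trans ?_
  rw [lintegral_add_left (by fun_prop), two_mul]
  refine add_le_add (h l) ((h (-l)).trans (le_of_eq ?_))
  rw [mul_neg, phiPow_neg]

/-- From `y ≤ exp y` at `y = |ξ| / a`: the first moment is linear in the constant. -/
lemma ExpBound.lintegral_abs_le (hξ : Measurable ξ) (h : ExpBound (phiPow ζ) P ξ a)
    (ha : 0 < a) :
    ∫⁻ ω, ENNReal.ofReal |ξ ω| ∂P ≤ ENNReal.ofReal (2 * Real.exp (1 / ζ) * a) := by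
  have key : ∀ ω, ENNReal.ofReal |ξ ω| ≤
      ENNReal.ofReal a * ENNReal.ofReal (Real.exp (1 / a * |ξ ω|)) := by
    intro ω
    rw [← ENNReal.ofReal_mul ha.le]
    refine ENNReal.ofReal_le_ofReal ?_
    have := Real.add_one_le_exp (1 / a * |ξ ω|)
    calc |ξ ω| = a * (1 / a * |ξ ω|) := by field_simp
      _ ≤ _ := by gcongr; linarith
  refine (lintegral_mono key).trans ?_
  rw [lintegral_const_mul' _ _ ENNReal.ofReal_ne_top]
  refine (mul_le_mul_right (h.lintegral_exp_abs_le hξ (1 / a)) _).trans (le_of_eq ?_)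
  rw [mul_one_div_cancel ha.ne', phiPow, abs_one, Real.one_rpow, mul_comm _ a,
    ENNReal.ofReal_mul ha.le, ENNReal.ofReal_mul two_pos.le, ENNReal.ofReal_ofNat]

lemma ExpBound.integrable (hζ : 0 < ζ) (hξ : Measurable ξ) (h : ExpBound (phiPow ζ) P ξ a)
    (ha : 0 ≤ a) : Integrable ξ P := by
  refine ⟨hξ.aestronglyMeasurable, ?_⟩
  rw [hasFiniteIntegral_iff_norm]
  exact ((h.mono hζ ha (by linarith : a ≤ a + 1)).lintegral_abs_le hξ (by linarith)).trans_lt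
    ENNReal.ofReal_lt_top

lemma ExpBound.ae_eq_zero (hζ : 0 < ζ) (hξ : Measurable ξ) (h : ExpBound (phiPow ζ) P ξ 0) :
    ∀ᵐ ω ∂P, ξ ω = 0 := by
  have h0 : ∫⁻ ω, ENNReal.ofReal |ξ ω| ∂P ≤ 0 := by
    have ht : Tendsto (fun a : ℝ => ENNReal.ofReal (2 * Real.exp (1 / ζ) * a)) (𝓝[>] 0) (𝓝 0) := by
      have : Continuous (fun a : ℝ => ENNReal.ofReal (2 * Real.exp (1 / ζ) * a)) :=
        ENNReal.continuous_ofReal.comp (by fun_prop)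
      simpa using (this.tendsto 0).mono_left nhdsWithin_le_nhds
    refine ge_of_tendsto ht ?_
    filter_upwards [self_mem_nhdsWithin] with a ha
    exact (h.mono hζ le_rfl (le_of_lt ha)).lintegral_abs_le hξ ha
  have := (lintegral_eq_zero_iff (by fun_prop)).1 (le_antisymm h0 bot_le)
  filter_upwards [this] with ω hω
  simpa using hω

lemma ExpBound.integrable_exp (hξ : Measurable ξ) (h : ExpBound (phiPow ζ) P ξ a) (l : ℝ) :
    Integrable (fun ω => Real.exp (l * ξ ω)) P := by
  refine ⟨by fun_prop, ?_⟩
  rw [hasFiniteIntegral_iff_ofReal (ae_of_all _ fun _ => (Real.exp_pos _).le)]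
  exact (h l).trans_lt ENNReal.ofReal_lt_top

lemma ExpBound.one_add_integral_le [IsProbabilityMeasure P] (hζ : 0 < ζ) (hξ : Measurable ξ)
    (ha : 0 ≤ a) (h : ExpBound (phiPow ζ) P ξ a) (l : ℝ) :
    1 + l * ∫ ω, ξ ω ∂P ≤ ∫ ω, Real.exp (l * ξ ω) ∂P := by
  have hi := h.integrable hζ hξ ha
  calc 1 + l * ∫ ω, ξ ω ∂P = ∫ ω, (1 + l * ξ ω) ∂P := by
        rw [integral_add (integrable_const _) (hi.const_mul l), integral_const_mul]
        simp
    _ ≤ _ := integral_mono ((integrable_const _).add (hi.const_mul l)) (h.integrable_exp hξ l)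
        fun ω => by have := Real.add_one_le_exp (l * ξ ω); simp only; linarith

/-- From `1 + l Eξ ≤ E exp(lξ) ≤ exp(C l^ζ)`, divide by `l` and let `l → 0`; the right side vanishes
because `ζ > 1`. Applied to `-ξ` as well, this shows that `ξ` is centred. -/
lemma ExpBound.integral_nonpos [IsProbabilityMeasure P] (hζ : 1 < ζ) (hξ : Measurable ξ)
    (ha : 0 ≤ a) (h : ExpBound (phiPow ζ) P ξ a) : ∫ ω, ξ ω ∂P ≤ 0 := by
  have hζ0 : 0 < ζ := by linarith
  set C := a ^ ζ / ζ with hC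
  have hbound : ∀ l : ℝ, 0 < l → ∫ ω, ξ ω ∂P ≤
      C * l ^ (ζ - 1) * Real.exp (C * l ^ ζ) := by
    intro l hl
    have h1 := h.one_add_integral_le hζ0 hξ ha l
    have h2 : ∫ ω, Real.exp (l * ξ ω) ∂P ≤ Real.exp (phiPow ζ (a * l)) := by
      rw [integral_eq_lintegral_of_nonneg_ae (ae_of_all _ fun _ => (Real.exp_pos _).le)
        (by fun_prop)]
      exact ENNReal.toReal_le_of_le_ofReal (Real.exp_pos _).le (h l)
    have h3 : phiPow ζ (a * l) = C * l ^ ζ := by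
      rw [phiPow, abs_of_nonneg (by positivity), Real.mul_rpow ha hl.le, hC]; ring
    rw [h3] at h2
    -- This is `1 - y ≤ exp(-y)` multiplied by `exp y`.
    have h4 : Real.exp (C * l ^ ζ) - 1 ≤ C * l ^ ζ * Real.exp (C * l ^ ζ) := by
      have := Real.add_one_le_exp (-(C * l ^ ζ))
      have h5 := mul_le_mul_of_nonneg_right this (Real.exp_pos (C * l ^ ζ)).le
      rw [← Real.exp_add, neg_add_cancel, Real.exp_zero] at h5
      linarith
    have h5 : l ^ ζ = l * l ^ (ζ - 1) := by
      rw [Real.rpow_sub_one hl.ne']; field_simp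
    have h6 : l * ∫ ω, ξ ω ∂P ≤ l * (C * l ^ (ζ - 1) * Real.exp (C * l ^ ζ)) := by
      calc l * ∫ ω, ξ ω ∂P ≤ C * l ^ ζ * Real.exp (C * l ^ ζ) := by linarith
        _ = l * (C * l ^ (ζ - 1) * Real.exp (C * l ^ ζ)) := by
          nth_rewrite 1 [h5]; ring
    exact le_of_mul_le_mul_left h6 hl
  have hcont : Continuous fun l : ℝ => C * l ^ (ζ - 1) * Real.exp (C * l ^ ζ) := by
    refine (continuous_const.mul (Real.continuous_rpow_const (by linarith))).mul
      (Real.continuous_exp.comp (continuous_const.mul (Real.continuous_rpow_const hζ0.le)))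
  have ht : Tendsto (fun l : ℝ => C * l ^ (ζ - 1) * Real.exp (C * l ^ ζ)) (𝓝[>] 0) (𝓝 0) := by
    have := (hcont.tendsto 0).mono_left (nhdsWithin_le_nhds (s := Ioi 0))
    rwa [Real.zero_rpow (by linarith), mul_zero, zero_mul] at this
  exact ge_of_tendsto ht (by filter_upwards [self_mem_nhdsWithin] with l hl using hbound l hl)

lemma ExpBound.integral_eq_zero [IsProbabilityMeasure P] (hζ : 1 < ζ) (hξ : Measurable ξ)
    (ha : 0 ≤ a) (h : ExpBound (phiPow ζ) P ξ a) : ∫ ω, ξ ω ∂P = 0 := by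
  refine le_antisymm (h.integral_nonpos hζ hξ ha) ?_
  have := ExpBound.integral_nonpos (ξ := fun ω => ξ ω * (-1)) hζ (hξ.mul_const _) ha
    (by simpa using h.const_mul (-1))
  rw [integral_mul_const] at this
  linarith

/-- Since `ξ` is centred, integrating `1 + lξ ≤ exp(lξ)` suffices. It allows factors to be dropped
from products of exponential moments. -/
lemma IsPhiSubGaussian.one_le_lintegral_exp [IsProbabilityMeasure P] (hζ : 1 < ζ)
    (h : IsPhiSubGaussian (phiPow ζ) P ξ) (l : ℝ) :
    1 ≤ ∫⁻ ω, ENNReal.ofReal (Real.exp (l * ξ ω)) ∂P := by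
  obtain ⟨hξ, a, ha, h⟩ := h
  have h1 := h.one_add_integral_le (by linarith) hξ ha l
  rw [h.integral_eq_zero hζ hξ ha, mul_zero, add_zero] at h1
  rw [← ofReal_integral_eq_lintegral_ofReal (h.integrable_exp hξ l)
    (ae_of_all _ fun _ => (Real.exp_pos _).le)]
  exact ENNReal.one_le_ofReal.2 h1

end SubGaussian

/-! ### Sums of independent terms. -/

section Independent

variable {Ω : Type*} [MeasurableSpace Ω] {P : Measure Ω} {ζ : ℝ} {ξ : ℕ → Ω → ℝ}

lemma lintegral_exp_sum_eq_prod (hm : ∀ k, Measurable (ξ k)) (hind : iIndepFun ξ P)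
    (s : Finset ℕ) (c : ℕ → ℝ) (l : ℝ) :
    ∫⁻ ω, ENNReal.ofReal (Real.exp (l * ∑ k ∈ s, ξ k ω * c k)) ∂P =
      ∏ k ∈ s, ∫⁻ ω, ENNReal.ofReal (Real.exp (l * (ξ k ω * c k))) ∂P := by
  rw [← lintegral_prod_eq_prod_lintegral_of_indepFun s
    (fun k ω => ENNReal.ofReal (Real.exp (l * (ξ k ω * c k)))) ?_ (fun k => by fun_prop)]
  · refine lintegral_congr fun ω => ?_
    rw [Finset.mul_sum, Real.exp_sum, ENNReal.ofReal_prod_of_nonneg fun _ _ => (Real.exp_pos _).le]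
  · exact hind.comp (fun k x => ENNReal.ofReal (Real.exp (l * (x * c k)))) fun k => by fun_prop

lemma lintegral_exp_sum_le (hζ : 0 < ζ) (hξ : ∀ k, IsPhiSubGaussian (phiPow ζ) P (ξ k))
    (hind : iIndepFun ξ P) (s : Finset ℕ) (c : ℕ → ℝ) (l : ℝ) :
    ∫⁻ ω, ENNReal.ofReal (Real.exp (l * ∑ k ∈ s, ξ k ω * c k)) ∂P ≤
      ENNReal.ofReal (Real.exp
        (|l| ^ ζ * (∑ k ∈ s, tauPhi (phiPow ζ) P (ξ k) ^ ζ * |c k| ^ ζ) / ζ)) := by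
  rw [lintegral_exp_sum_eq_prod (fun k => (hξ k).1) hind, Finset.mul_sum, Finset.sum_div,
    Real.exp_sum, ENNReal.ofReal_prod_of_nonneg fun _ _ => (Real.exp_pos _).le]
  refine Finset.prod_le_prod' fun k _ => ?_
  refine (((hξ k).expBound_tauPhi hζ).const_mul (c k) l).trans (le_of_eq ?_)
  have := tauPhi_nonneg (phiPow ζ) P (ξ k)
  rw [phiPow, abs_mul, abs_mul, abs_abs, abs_of_nonneg this, Real.mul_rpow (by positivity)
    (by positivity), Real.mul_rpow (by positivity) (by positivity)]
  ring_nf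

/-- The exponential moment of the sum is a product of factors that are all at least 1, so it
dominates each single factor. -/
lemma abs_mul_tauPhi_le [IsProbabilityMeasure P] (hζ : 1 < ζ) (hξ : ∀ k, IsPhiSubGaussian (phiPow ζ) P (ξ k))
    (hind : iIndepFun ξ P) {s : Finset ℕ} (c : ℕ → ℝ) {j : ℕ} (hj : j ∈ s) :
    |c j| * tauPhi (phiPow ζ) P (ξ j) ≤
      tauPhi (phiPow ζ) P (fun ω => ∑ k ∈ s, ξ k ω * c k) := by
  have hζ0 : 0 < ζ := by linarith
  set A := tauPhi (phiPow ζ) P (fun ω => ∑ k ∈ s, ξ k ω * c k) with hA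
  have hA0 : 0 ≤ A := tauPhi_nonneg _ _ _
  rcases eq_or_ne (c j) 0 with h0 | h0
  · simpa [h0] using hA0
  have hcj : 0 < |c j| := abs_pos.2 h0
  have hS : ExpBound (phiPow ζ) P (fun ω => ∑ k ∈ s, ξ k ω * c k) A :=
    (IsPhiSubGaussian.sum hζ0 s fun k => (hξ k).const_mul (c k)).expBound_tauPhi hζ0
  have hb : ExpBound (phiPow ζ) P (fun ω => ξ j ω * c j) A := by
    intro l
    refine le_trans ?_ (hS l)
    rw [lintegral_exp_sum_eq_prod (fun k => (hξ k).1) hind]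
    exact Finset.single_le_prod' (f := fun k => ∫⁻ ω, ENNReal.ofReal
      (Real.exp (l * (ξ k ω * c k))) ∂P)
      (fun k _ => ((hξ k).const_mul (c k)).one_le_lintegral_exp hζ l) hj
  have hb' : ExpBound (phiPow ζ) P (ξ j) (|(c j)⁻¹| * A) := by
    have := hb.const_mul (c j)⁻¹
    simpa [mul_assoc, h0] using this
  have := tauPhi_le (by positivity) hb'
  rw [abs_inv] at this
  calc |c j| * tauPhi (phiPow ζ) P (ξ j) ≤ |c j| * (|c j|⁻¹ * A) := by gcongr
    _ = A := by field_simp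

end Independent

/-! ### Mean-square series and the estimate of the error's standard. -/

section Series

variable {Ω : Type*} [MeasurableSpace Ω] {P : Measure Ω} {ζ : ℝ}

lemma lintegral_le_of_ae_le_liminf {f : Ω → ENNReal} {g : ℕ → Ω → ENNReal} {A : ENNReal}
    (hg : ∀ n, Measurable (g n)) (hfg : ∀ᵐ ω ∂P, f ω ≤ liminf (fun n => g n ω) atTop)
    (hA : ∀ᶠ n in atTop, ∫⁻ ω, g n ω ∂P ≤ A) : ∫⁻ ω, f ω ∂P ≤ A :=
  ((lintegral_mono_ae hfg).trans (lintegral_liminf_le hg)).trans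
    (liminf_le_of_frequently_le' hA.frequently)

/-- A subsequence converges almost everywhere, and Fatou carries the uniform bound to the limit. -/
lemma expBound_of_tendsto_eLpNorm {Y : Ω → ℝ} {S : ℕ → Ω → ℝ} {φ : ℝ → ℝ} {A : ℝ}
    (hY : Measurable Y) (hS : ∀ n, Measurable (S n))
    (hYS : Tendsto (fun n => eLpNorm (fun ω => Y ω - S n ω) 2 P) atTop (𝓝 0))
    (hA : ∀ n, ExpBound φ P (S n) A) : ExpBound φ P Y A := by
  have hYS' : Tendsto (fun n => eLpNorm (S n - Y) 2 P) atTop (𝓝 0) := by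
    refine hYS.congr fun n => ?_
    rw [eLpNorm_sub_comm]
    rfl
  obtain ⟨ns, -, hns⟩ := (tendstoInMeasure_of_tendsto_eLpNorm two_ne_zero
    (fun n => (hS n).aestronglyMeasurable) hY.aestronglyMeasurable hYS').exists_seq_tendsto_ae
  intro l
  refine lintegral_le_of_ae_le_liminf
    (g := fun n ω => ENNReal.ofReal (Real.exp (l * S (ns n) ω)))
    (fun n => by have := hS (ns n); fun_prop) ?_ (Eventually.of_forall fun n => hA (ns n) l)
  filter_upwards [hns] with ω hω
  have : Continuous fun x : ℝ => ENNReal.ofReal (Real.exp (l * x)) :=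
    ENNReal.continuous_ofReal.comp (by fun_prop)
  exact ((this.tendsto _).comp hω).liminf_eq.ge

lemma ofReal_tauPhi_rpow_le_tsum (hζ : 0 < ζ) {ξ : ℕ → Ω → ℝ}
    (hξ : ∀ k, IsPhiSubGaussian (phiPow ζ) P (ξ k)) (hind : iIndepFun ξ P) {Y : Ω → ℝ}
    (hY : Measurable Y) (c : ℕ → ℝ)
    (hYc : Tendsto (fun n : ℕ => eLpNorm (fun ω => Y ω - ∑ k ∈ Finset.range n, ξ k ω * c k) 2 P)
      atTop (𝓝 0)) :
    ENNReal.ofReal (tauPhi (phiPow ζ) P Y ^ ζ) ≤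
      ∑' k, ENNReal.ofReal (tauPhi (phiPow ζ) P (ξ k) ^ ζ) * ENNReal.ofReal (|c k| ^ ζ) := by
  set R := ∑' k, ENNReal.ofReal (tauPhi (phiPow ζ) P (ξ k) ^ ζ) * ENNReal.ofReal (|c k| ^ ζ)
    with hR
  rcases eq_or_ne R ⊤ with h | h
  · rw [h]; exact le_top
  have hpos : ∀ k, 0 ≤ tauPhi (phiPow ζ) P (ξ k) ^ ζ := fun k =>
    Real.rpow_nonneg (tauPhi_nonneg _ _ _) _
  have hpos' : ∀ k, 0 ≤ tauPhi (phiPow ζ) P (ξ k) ^ ζ * |c k| ^ ζ := fun k =>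
    mul_nonneg (hpos k) (by positivity)
  have hpart : ∀ n, ∑ k ∈ Finset.range n, tauPhi (phiPow ζ) P (ξ k) ^ ζ * |c k| ^ ζ ≤
      R.toReal := by
    intro n
    rw [← ENNReal.ofReal_le_iff_le_toReal h, ENNReal.ofReal_sum_of_nonneg fun k _ => hpos' k]
    simp_rw [fun k => ENNReal.ofReal_mul (q := |c k| ^ ζ) (hpos k)]
    exact ENNReal.sum_le_tsum _
  have hb : ExpBound (phiPow ζ) P Y (R.toReal ^ (1 / ζ)) := by
    refine expBound_of_tendsto_eLpNorm hY
      (fun n => Finset.measurable_sum _ fun k _ => (hξ k).1.mul_const _) hYc fun n l => ?_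
    refine (lintegral_exp_sum_le hζ hξ hind _ c l).trans ?_
    refine ENNReal.ofReal_le_ofReal (Real.exp_le_exp.2 ?_)
    rw [phiPow, abs_mul, Real.mul_rpow (abs_nonneg _) (abs_nonneg _),
      abs_of_nonneg (Real.rpow_nonneg ENNReal.toReal_nonneg (1 / ζ)),
      ← Real.rpow_mul ENNReal.toReal_nonneg, one_div_mul_cancel hζ.ne', Real.rpow_one, mul_comm R.toReal]
    gcongr
    exact hpart n
  refine ENNReal.ofReal_le_of_le_toReal ?_
  calc tauPhi (phiPow ζ) P Y ^ ζ ≤ (R.toReal ^ (1 / ζ)) ^ ζ :=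
        Real.rpow_le_rpow (tauPhi_nonneg _ _ _) (tauPhi_le (by positivity) hb) hζ.le
    _ = R.toReal := by
        rw [← Real.rpow_mul ENNReal.toReal_nonneg, one_div_mul_cancel hζ.ne', Real.rpow_one]

lemma ofReal_ciSup_rpow_le {B : Type*} [Nonempty B] (hζ : 0 < ζ) {f : B → ℝ} (hf : ∀ u, 0 ≤ f u)
    {R : ENNReal} (h : ∀ u, ENNReal.ofReal (f u ^ ζ) ≤ R) :
    ENNReal.ofReal ((⨆ u, f u) ^ ζ) ≤ R := by
  rcases eq_or_ne R ⊤ with hR | hR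
  · rw [hR]; exact le_top
  refine ENNReal.ofReal_le_of_le_toReal ?_
  have hsup : (⨆ u, f u) ≤ R.toReal ^ (1 / ζ) := by
    refine ciSup_le fun u => ?_
    have := (ENNReal.ofReal_le_iff_le_toReal hR).1 (h u)
    calc f u = (f u ^ ζ) ^ (1 / ζ) := by
          rw [← Real.rpow_mul (hf u), mul_one_div_cancel hζ.ne', Real.rpow_one]
      _ ≤ _ := Real.rpow_le_rpow (Real.rpow_nonneg (hf u) _) this (by positivity)
  calc (⨆ u, f u) ^ ζ ≤ (R.toReal ^ (1 / ζ)) ^ ζ :=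
        Real.rpow_le_rpow (Real.iSup_nonneg hf) hsup hζ.le
    _ = R.toReal := by
        rw [← Real.rpow_mul ENNReal.toReal_nonneg, one_div_mul_cancel hζ.ne', Real.rpow_one]

variable {B : Type*}

lemma ofReal_tauPhi_error_rpow_le (hζ : 0 < ζ) {ξ : ℕ → Ω → ℝ}
    (hξ : ∀ k, IsPhiSubGaussian (phiPow ζ) P (ξ k)) (hind : iIndepFun ξ P)
    {X : B → Ω → ℝ} (hX : ∀ t, Measurable (X t)) {a : ℕ → B → ℝ}
    (hseries : IsMeanSquareSeries P X ξ a) (b : ℕ → B → ℝ) (N : ℕ) (u : B) :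
    ENNReal.ofReal (tauPhi (phiPow ζ) P (fun ω => X u ω - model ξ b N u ω) ^ ζ) ≤
      ∑ k ∈ Finset.range N, ENNReal.ofReal (tauPhi (phiPow ζ) P (ξ k) ^ ζ) *
          (⨆ u : B, ENNReal.ofReal (|a k u - b k u| ^ ζ)) +
        ∑' k : ℕ, ENNReal.ofReal (tauPhi (phiPow ζ) P (ξ (N + k)) ^ ζ) *
          (⨆ u : B, ENNReal.ofReal (|a (N + k) u| ^ ζ)) := by
  -- The error is itself a mean-square series in the `ξ k` with these coefficients; its remainders
  -- agree with those of `X` once `n ≥ N`.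
  set c : ℕ → ℝ := fun k => if k < N then a k u - b k u else a k u with hc
  have hmodel : Measurable (model ξ b N u) :=
    Finset.measurable_sum _ fun k _ => (hξ k).1.mul_const _
  have hlim : Tendsto (fun n : ℕ => eLpNorm (fun ω => (X u ω - model ξ b N u ω) -
      ∑ k ∈ Finset.range n, ξ k ω * c k) 2 P) atTop (𝓝 0) := by
    refine (hseries u).congr' ?_
    filter_upwards [eventually_ge_atTop N] with n hn
    congr 1
    ext ω
    have h1 : ∀ k, ξ k ω * c k = ξ k ω * a k u - if k < N then ξ k ω * b k u else 0 := by
      intro k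
      simp only [hc]
      split_ifs <;> ring
    have h2 : (Finset.range n).filter (· < N) = Finset.range N := by
      ext k
      simp only [Finset.mem_filter, Finset.mem_range]
      omega
    simp_rw [h1]
    rw [Finset.sum_sub_distrib, ← Finset.sum_filter, h2, model]
    ring
  refine (ofReal_tauPhi_rpow_le_tsum hζ hξ hind ((hX u).sub hmodel) c hlim).trans ?_
  rw [← ENNReal.summable.sum_add_tsum_nat_add' (k := N)]
  refine add_le_add (Finset.sum_le_sum fun k hk => ?_) (ENNReal.tsum_le_tsum fun k => ?_)
  · simp only [hc]
    rw [if_pos (Finset.mem_range.1 hk)]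
    gcongr
    exact le_iSup (fun u => ENNReal.ofReal (|a k u - b k u| ^ ζ)) u
  · simp only [hc]
    rw [if_neg (by omega), add_comm k N]
    gcongr
    exact le_iSup (fun u => ENNReal.ofReal (|a (N + k) u| ^ ζ)) u

end Series

/-! ### Path continuity of the model and reduction to a countable set. -/

section Separability

variable {Ω B : Type*} [MeasurableSpace Ω] {P : Measure Ω} {ζ : ℝ} [MetricSpace B]

/-- An increment of the model is an independent sum with coefficients `b k t - b k s`, so its
standard controls each of them. -/
lemma continuous_coeff_of_incrementsBoundedBy [IsProbabilityMeasure P] (hζ : 1 < ζ)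
    {ξ : ℕ → Ω → ℝ}
    (hξ : ∀ k, IsPhiSubGaussian (phiPow ζ) P (ξ k)) (hind : iIndepFun ξ P) {b : ℕ → B → ℝ}
    {N : ℕ} {w : ℝ → ℝ} (hw : Tendsto w (𝓝[>] 0) (𝓝 0))
    (hinc : IncrementsBoundedBy (phiPow ζ) P (model ξ b N) w) {k : ℕ} (hk : k < N)
    (hτ : tauPhi (phiPow ζ) P (ξ k) ≠ 0) : Continuous (b k) := by
  have hτ0 : 0 < tauPhi (phiPow ζ) P (ξ k) := lt_of_le_of_ne (tauPhi_nonneg _ _ _) hτ.symm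
  have hle : ∀ t s : B, t ≠ s → |b k t - b k s| ≤ w (dist t s) / tauPhi (phiPow ζ) P (ξ k) := by
    intro t s hts
    rw [le_div_iff₀ hτ0]
    refine (abs_mul_tauPhi_le hζ hξ hind (fun k => b k t - b k s)
      (Finset.mem_range.2 hk)).trans ?_
    have := hinc (dist t s) (dist_pos.2 hts) t s le_rfl
    simp only [model, ← Finset.sum_sub_distrib, ← mul_sub] at this
    exact this
  refine Metric.continuous_iff.2 fun s ε hε => ?_
  have hev : ∀ᶠ h in 𝓝[>] (0 : ℝ), w h < ε * tauPhi (phiPow ζ) P (ξ k) :=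
    hw.eventually_lt_const (by positivity)
  obtain ⟨δ, hδ, hsub⟩ := mem_nhdsGT_iff_exists_Ioo_subset.1 hev
  refine ⟨δ, hδ, fun t ht => ?_⟩
  rcases eq_or_ne t s with rfl | hne
  · simpa using hε
  rw [Real.dist_eq]
  refine (hle t s hne).trans_lt ?_
  rw [div_lt_iff₀ hτ0]
  exact hsub ⟨dist_pos.2 hne, ht⟩

lemma ae_continuous_model [IsProbabilityMeasure P] (hζ : 1 < ζ) {ξ : ℕ → Ω → ℝ}
    (hξ : ∀ k, IsPhiSubGaussian (phiPow ζ) P (ξ k)) (hind : iIndepFun ξ P) {b : ℕ → B → ℝ}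
    {N : ℕ} {w : ℝ → ℝ} (hw : Tendsto w (𝓝[>] 0) (𝓝 0))
    (hinc : IncrementsBoundedBy (phiPow ζ) P (model ξ b N) w) :
    ∀ᵐ ω ∂P, Continuous fun t => model ξ b N t ω := by
  have h : ∀ᵐ ω ∂P, ∀ k, tauPhi (phiPow ζ) P (ξ k) = 0 → ξ k ω = 0 := by
    refine ae_all_iff.2 fun k => ?_
    by_cases hτ : tauPhi (phiPow ζ) P (ξ k) = 0
    · have hb := (hξ k).expBound_tauPhi (by linarith)
      rw [hτ] at hb
      filter_upwards [hb.ae_eq_zero (by linarith) (hξ k).1] with ω hω _ using hω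
    · exact ae_of_all _ fun ω h => absurd h hτ
  filter_upwards [h] with ω hω
  refine continuous_finsetSum _ fun k hk => ?_
  -- When the standard vanishes, so does `ξ k` almost surely, and the regularity of `b k` is
  -- irrelevant.
  by_cases hτ : tauPhi (phiPow ζ) P (ξ k) = 0
  · simpa [hω k hτ] using continuous_const
  · exact continuous_const.mul
      (continuous_coeff_of_incrementsBoundedBy hζ hξ hind hw hinc (Finset.mem_range.1 hk) hτ)

/-- Near `t` the continuous path of `Y` is almost constant, so separability of `X` applies with a
closed interval around `Y t ω`. -/
lemma IsSeparableProcess.sub_continuous {X Y : B → Ω → ℝ} (hX : IsSeparableProcess P X)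
    (hY : ∀ᵐ ω ∂P, Continuous fun t => Y t ω) :
    ∃ S : Set B, S.Countable ∧ ∀ᵐ ω ∂P, ∀ δ t, δ < |X t ω - Y t ω| →
      ∃ s ∈ S, δ < |X s ω - Y s ω| := by
  obtain ⟨S, hS, -, hsep⟩ := hX
  refine ⟨S, hS, ?_⟩
  filter_upwards [hsep, hY] with ω hsep hY δ t ht
  by_contra! hcon
  -- Half of the excess over `δ`, so that `δ + ε` is still below the value at `t`.
  set ε := (|X t ω - Y t ω| - δ) / 2 with hε
  have hε0 : 0 < ε := by rw [hε]; linarith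
  have hU : IsOpen {s | |Y s ω - Y t ω| < ε} :=
    isOpen_lt (hY.sub continuous_const).abs continuous_const
  have hF : IsClosed {x : ℝ | |x - Y t ω| ≤ δ + ε} :=
    isClosed_le (continuous_id.sub continuous_const).abs continuous_const
  have hmem : |X t ω - Y t ω| ≤ δ + ε := by
    refine hsep _ hU _ hF ?_ t (by simpa using hε0)
    rintro s ⟨hs, hsS⟩
    calc |X s ω - Y t ω| = |(X s ω - Y s ω) + (Y s ω - Y t ω)| := by ring_nf
      _ ≤ |X s ω - Y s ω| + |Y s ω - Y t ω| := abs_add_le _ _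
      _ ≤ δ + ε := add_le_add (hcon s hsS) (le_of_lt hs)
  linarith

end Separability

/-! ### Jensen's inequality for the gauge, its inverse, and the integral comparison. -/

section Gauge

variable {r : ℝ → ℝ}

/-- A net with one point gives `log 1 = 0`, so convexity is needed at the endpoint too; it follows
by shifting both points by `ε` and letting `ε → 0`. -/
lemma IsEntropyGauge.convexOn_comp_exp (hr : IsEntropyGauge r) :
    ConvexOn ℝ (Ici 0) (fun t => r (Real.exp t)) := by
  obtain ⟨hc, -, -, hconv⟩ := hr
  have hcont : ContinuousOn (fun t => r (Real.exp t)) (Ici 0) :=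
    hc.comp Real.continuous_exp.continuousOn fun t ht => Real.one_le_exp ht
  have hlim : ∀ x : ℝ, 0 ≤ x →
      Tendsto (fun ε => r (Real.exp (x + ε))) (𝓝[>] 0) (𝓝 (r (Real.exp x))) := by
    intro x hx
    refine (hcont x hx).tendsto.comp (tendsto_nhdsWithin_iff.2 ⟨?_, ?_⟩)
    · have : Tendsto (fun ε : ℝ => x + ε) (𝓝 0) (𝓝 (x + 0)) :=
        (continuous_const.add continuous_id).tendsto 0
      rw [add_zero] at this
      exact this.mono_left nhdsWithin_le_nhds
    · filter_upwards [self_mem_nhdsWithin] with ε hε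
      exact add_nonneg hx (le_of_lt hε)
  refine ⟨convex_Ici 0, fun x hx y hy a b ha hb hab => ?_⟩
  have hxy : 0 ≤ a • x + b • y := add_nonneg (mul_nonneg ha hx) (mul_nonneg hb hy)
  refine le_of_tendsto_of_tendsto (hlim _ hxy)
    (((hlim x hx).const_smul a).add ((hlim y hy).const_smul b)) ?_
  filter_upwards [self_mem_nhdsWithin] with ε hε
  have h := hconv.2 (show x + ε ∈ Ioi 0 from mem_Ioi.2 (add_pos_of_nonneg_of_pos hx hε))
    (show y + ε ∈ Ioi 0 from mem_Ioi.2 (add_pos_of_nonneg_of_pos hy hε)) ha hb hab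
  have e : a • (x + ε) + b • (y + ε) = a • x + b • y + ε := by
    simp only [smul_eq_mul]
    linear_combination ε * hab
  rwa [e] at h

/-- Jensen with the leftover weight `v` of a truncated geometric series placed at `0 = log 1`. -/
lemma IsEntropyGauge.map_exp_sum_log_le (hr : IsEntropyGauge r) (s : Finset ℕ) {w n : ℕ → ℝ}
    {v : ℝ} (hw : ∀ k, 0 ≤ w k) (hv : 0 ≤ v) (hsum : v + ∑ k ∈ s, w k = 1)
    (hn : ∀ k, 1 ≤ n k) :
    r (Real.exp (∑ k ∈ s, w k * Real.log (n k))) ≤ ∑ k ∈ s, w k * r (n k) + v * r 1 := by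
  have := hr.convexOn_comp_exp.map_add_sum_le (t := s) (p := fun k => Real.log (n k)) (q := 0)
    (fun k _ => hw k) hsum (fun k _ => Real.log_nonneg (hn k)) hv (self_mem_Ici)
  simp only [smul_eq_mul, mul_zero, zero_add, Real.exp_zero] at this
  simp_rw [fun k => Real.exp_log (zero_lt_one.trans_le (hn k))] at this
  linarith

lemma exp_sum_le (s : Finset ℕ) {w x : ℕ → ℝ} {v : ℝ} (hw : ∀ k, 0 ≤ w k) (hv : 0 ≤ v)
    (hsum : v + ∑ k ∈ s, w k = 1) :
    Real.exp (∑ k ∈ s, w k * x k) ≤ ∑ k ∈ s, w k * Real.exp (x k) + v := by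
  have := convexOn_exp.map_add_sum_le (t := s) (p := x) (q := 0)
    (fun k _ => hw k) hsum (fun k _ => mem_univ _) hv (mem_univ _)
  simp only [smul_eq_mul, mul_zero, zero_add, Real.exp_zero, mul_one] at this
  linarith

/-- A strictly increasing convex function grows at least linearly, here with the slope of `r ∘ exp`
between 1 and 2. Hence `invFunOn` is a true inverse at every level above a value of `r`. -/
lemma IsEntropyGauge.exists_le (hr : IsEntropyGauge r) (I : ℝ) : ∃ u, 1 ≤ u ∧ I ≤ r u := by
  set f := fun t => r (Real.exp t) with hf
  have hs : 0 < f 2 - f 1 := sub_pos.2 (hr.2.1 (Real.one_le_exp (by norm_num))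
    (Real.one_le_exp (by norm_num)) (Real.exp_lt_exp.2 (by norm_num)))
  -- The second entry is where the chord line reaches `I`; the bound 3 places 2 between 1 and `t`.
  set t := max 3 (1 + (I - f 1) / (f 2 - f 1)) with ht
  have ht3 : 3 ≤ t := le_max_left _ _
  refine ⟨Real.exp t, Real.one_le_exp (by linarith), ?_⟩
  have h1 : (I - f 1) / (f 2 - f 1) ≤ t - 1 := by
    have := le_max_right 3 (1 + (I - f 1) / (f 2 - f 1)); linarith
  rw [div_le_iff₀ hs] at h1
  have h2 := hr.convexOn_comp_exp.2 (show (1 : ℝ) ∈ Ici 0 from mem_Ici.2 zero_le_one)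
    (show t ∈ Ici 0 from mem_Ici.2 (by linarith))
    (show 0 ≤ (t - 2) / (t - 1) from div_nonneg (by linarith) (by linarith))
    (show 0 ≤ 1 / (t - 1) from div_nonneg zero_le_one (by linarith))
    (by rw [← add_div, div_eq_one_iff_eq (by linarith)]; ring)
  have e : ((t - 2) / (t - 1)) • (1 : ℝ) + (1 / (t - 1)) • t = 2 := by
    have : t - 1 ≠ 0 := by linarith
    simp only [smul_eq_mul]; field_simp; ring
  rw [e] at h2
  change f 2 ≤ (t - 2) / (t - 1) * f 1 + 1 / (t - 1) * f t at h2
  have h3 : (t - 2) / (t - 1) * f 1 + 1 / (t - 1) * f t = ((t - 2) * f 1 + f t) / (t - 1) := by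
    ring
  rw [h3, le_div_iff₀ (by linarith)] at h2
  change I ≤ f t
  nlinarith

lemma IsEntropyGauge.le_gaugeInv (hr : IsEntropyGauge r) {G I : ℝ} (hG : 1 ≤ G) (h : r G ≤ I) :
    G ≤ gaugeInv r I := by
  obtain ⟨u, hu, hIu⟩ := hr.exists_le I
  have hGu : G ≤ u := (hr.2.1.le_iff_le hG hu).1 (h.trans hIu)
  obtain ⟨x, hx, hxI⟩ := intermediate_value_Icc hGu
    (hr.1.mono fun x hx => hG.trans hx.1) ⟨h, hIu⟩
  have hex : ∃ x ∈ Ici (1 : ℝ), r x = I := ⟨x, hG.trans hx.1, hxI⟩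
  refine (hr.2.1.le_iff_le hG (Function.invFunOn_mem hex)).1 ?_
  rw [Function.invFunOn_eq hex]
  exact h

/-- On `(b p^(k+1), b p^k]`, of length `b (1-p) p^k`, the function is at least its right end value;
the remaining `(0, b p^m]` contributes at least `b p^m c`. -/
lemma AntitoneOn.sum_geometric_le_integral {f : ℝ → ℝ} {b p c : ℝ} (hb : 0 < b) (hp : 0 < p)
    (hp1 : p < 1) (hf : AntitoneOn f (Ioc 0 b)) (hint : IntegrableOn f (Ioc 0 b))
    (hc : ∀ u ∈ Ioc 0 b, c ≤ f u) (m : ℕ) :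
    b * (∑ k ∈ Finset.range m, (1 - p) * p ^ k * f (b * p ^ k) + p ^ m * c) ≤
      ∫ u in (0 : ℝ)..b, f u := by
  have hbm : ∀ k : ℕ, 0 < b * p ^ k := fun k => by positivity
  have hbm' : ∀ k : ℕ, b * p ^ k ≤ b := fun k =>
    mul_le_of_le_one_right hb.le (pow_le_one₀ hp.le hp1.le)
  have hii : ∀ x y : ℝ, 0 ≤ x → x ≤ y → y ≤ b → IntervalIntegrable f volume x y := by
    intro x y hx hxy hy
    rw [intervalIntegrable_iff_integrableOn_Ioc_of_le hxy]
    exact hint.mono_set fun u hu => ⟨hx.trans_lt hu.1, hu.2.trans hy⟩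
  have hconst : ∀ x y d : ℝ, 0 ≤ x → x ≤ y → y ≤ b → (∀ u ∈ Ioc x y, d ≤ f u) →
      (y - x) * d ≤ ∫ u in x..y, f u := by
    intro x y d hx hxy hy hd
    have := intervalIntegral.integral_mono_on_of_le_Ioo (f := fun _ => d) hxy
      intervalIntegrable_const (hii x y hx hxy hy) fun u hu => hd u ⟨hu.1, hu.2.le⟩
    simpa using this
  have key : ∀ m : ℕ, b * ∑ k ∈ Finset.range m, (1 - p) * p ^ k * f (b * p ^ k) ≤
      ∫ u in (b * p ^ m)..b, f u := by
    intro m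
    induction m with
    | zero => simp
    | succ m ih =>
      have hle : b * p ^ (m + 1) ≤ b * p ^ m := by
        rw [pow_succ]
        exact mul_le_mul_of_nonneg_left (mul_le_of_le_one_right (by positivity) hp1.le) hb.le
      rw [← intervalIntegral.integral_add_adjacent_intervals
        (hii _ (b * p ^ m) (hbm _).le hle (hbm' m)) (hii _ _ (hbm m).le (hbm' m) le_rfl),
        Finset.sum_range_succ, mul_add]
      have := hconst (b * p ^ (m + 1)) (b * p ^ m) (f (b * p ^ m)) (hbm _).le hle (hbm' m)
        fun u hu => hf ⟨(hbm _).trans hu.1, hu.2.trans (hbm' m)⟩ ⟨hbm m, hbm' m⟩ hu.2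
      have e : b * ((1 - p) * p ^ m * f (b * p ^ m)) =
        (b * p ^ m - b * p ^ (m + 1)) * f (b * p ^ m) := by ring
      rw [e]
      linarith
  have h0 := hconst 0 (b * p ^ m) c le_rfl (hbm m).le (hbm' m)
    fun u hu => hc u ⟨hu.1, hu.2.trans (hbm' m)⟩
  rw [← intervalIntegral.integral_add_adjacent_intervals (b := b * p ^ m)
    (hii _ _ le_rfl (hbm m).le (hbm' m)) (hii _ _ (hbm m).le (hbm' m) le_rfl)]
  have := key m
  linarith

end Gauge

/-! ### Inverse modulus, covering numbers and the entropy integrand. -/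

section Entropy

lemma IsModulus.pos {σ : ℝ → ℝ} (hσ : IsModulus σ) {h : ℝ} (hh : 0 < h) : 0 < σ h := by
  have h2 : 0 ≤ σ (h / 2) := by
    refine le_of_tendsto hσ.2.2 ?_
    filter_upwards [Ioo_mem_nhdsGT (half_pos hh)] with x hx
    exact (hσ.2.1 hx.1 (half_pos hh) hx.2).le
  exact h2.trans_lt (hσ.2.1 (half_pos hh) hh (half_lt_self hh))

lemma IsModulus.modulusInv_spec {σ : ℝ → ℝ} (hσ : IsModulus σ) {h u : ℝ} (hh : 0 < h)
    (hu : 0 < u) (huh : u ≤ σ h) : 0 < modulusInv σ u ∧ σ (modulusInv σ u) = u := by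
  have hev : ∀ᶠ x in 𝓝[>] (0 : ℝ), σ x < u ∧ x ∈ Ioo 0 h :=
    (hσ.2.2.eventually_lt_const hu).and (Ioo_mem_nhdsGT hh)
  obtain ⟨x, hx, hx0, hxh⟩ := hev.exists
  obtain ⟨y, hy, hyu⟩ := intermediate_value_Icc hxh.le
    (hσ.1.mono fun y hy => hx0.trans_le hy.1) ⟨hx.le, huh⟩
  have hex : ∃ y ∈ Ioi (0 : ℝ), σ y = u := ⟨y, hx0.trans_le hy.1, hyu⟩
  exact ⟨Function.invFunOn_mem hex, Function.invFunOn_eq hex⟩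

lemma IsModulus.modulusInv_le {σ : ℝ → ℝ} (hσ : IsModulus σ) {h u v : ℝ} (hh : 0 < h)
    (hu : 0 < u) (huv : u ≤ v) (hvh : v ≤ σ h) : modulusInv σ u ≤ modulusInv σ v := by
  obtain ⟨h1, h2⟩ := hσ.modulusInv_spec hh hu (huv.trans hvh)
  obtain ⟨h3, h4⟩ := hσ.modulusInv_spec hh (hu.trans_le huv) hvh
  rw [← hσ.2.1.le_iff_le h1 h3, h2, h4]
  exact huv

variable {B : Type*} [MetricSpace B] [CompactSpace B]

lemma coveringNumber_univ_ne_top {u : ℝ} (hu : 0 < u) :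
    Metric.coveringNumber u.toNNReal (univ : Set B) ≠ ⊤ := by
  obtain ⟨t, ht, htf, hcov⟩ := Metric.exists_finite_isCover_of_isCompact
    (Real.toNNReal_pos.2 hu).ne' (isCompact_univ (X := B))
  exact ((Metric.IsCover.coveringNumber_le_encard (subset_univ t) hcov).trans_lt
    htf.encard_lt_top).ne

/-- Compactness keeps covering numbers finite, so `toNat` never sends `⊤` to 0. -/
lemma massiveness_anti {u v : ℝ} (hu : 0 < u) (huv : u ≤ v) :
    massiveness B v ≤ massiveness B u :=
  ENat.toNat_le_toNat (Metric.coveringNumber_anti (Real.toNNReal_le_toNNReal huv))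
    (coveringNumber_univ_ne_top hu)

lemma one_le_massiveness [Nonempty B] {u : ℝ} (hu : 0 < u) : 1 ≤ massiveness B u := by
  rw [Nat.one_le_iff_ne_zero, massiveness, Ne, ENat.toNat_eq_zero, not_or]
  exact ⟨(Metric.coveringNumber_pos_iff.2 univ_nonempty).ne', coveringNumber_univ_ne_top hu⟩

lemma exists_finset_card_eq_massiveness {u : ℝ} (hu : 0 < u) :
    ∃ V : Finset B, V.card = massiveness B u ∧ ∀ t, ∃ s ∈ V, dist t s ≤ u := by
  obtain ⟨C, -, hC, hcov, hcard⟩ := Metric.exists_set_encard_eq_coveringNumber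
    (coveringNumber_univ_ne_top (B := B) hu)
  refine ⟨hC.toFinset, ?_, fun t => ?_⟩
  · rw [massiveness, ← hcard, hC.encard_eq_coe_toFinset_card, ENat.toNat_natCast]
  · obtain ⟨s, hs, hts⟩ := hcov (mem_univ t)
    refine ⟨s, hC.mem_toFinset.2 hs, ?_⟩
    have : edist t s ≤ u.toNNReal := hts
    rw [edist_dist] at this
    exact (ENNReal.ofReal_le_ofReal_iff hu.le).1 this

/-- Of two distinct points, one is at least half their distance away from any given `s`. -/
lemma chebyshevRadius_pos [Nontrivial B] : 0 < chebyshevRadius B := by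
  obtain ⟨x, y, hxy⟩ := exists_pair_ne B
  have hbdd : ∀ s : B, BddAbove (range fun t : B => dist t s) := fun s =>
    (isCompact_range (continuous_id.dist continuous_const)).bddAbove
  refine lt_of_lt_of_le (half_pos (dist_pos.2 hxy)) (le_ciInf fun s => ?_)
  have h1 := le_ciSup (hbdd s) x
  have h2 := le_ciSup (hbdd s) y
  have := dist_triangle_right x y s
  linarith

lemma entropyIntegrand_antitoneOn [Nonempty B] {r σ : ℝ → ℝ} (hr : IsEntropyGauge r)
    (hσ : IsModulus σ) {h : ℝ} (hh : 0 < h) :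
    AntitoneOn (entropyIntegrand B r σ) (Ioc 0 (σ h)) := by
  intro u hu v hv huv
  have h1 := (hσ.modulusInv_spec hh hu.1 hu.2).1
  have h2 := (hσ.modulusInv_spec hh hv.1 hv.2).1
  refine hr.2.1.monotoneOn ?_ ?_ ?_
  · exact mem_Ici.2 (by exact_mod_cast one_le_massiveness h2)
  · exact mem_Ici.2 (by exact_mod_cast one_le_massiveness h1)
  · exact_mod_cast massiveness_anti h1 (hσ.modulusInv_le hh hu.1 huv hv.2)

lemma le_entropyIntegrand [Nonempty B] {r σ : ℝ → ℝ} (hr : IsEntropyGauge r)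
    (hσ : IsModulus σ) {h u : ℝ} (hh : 0 < h) (hu : u ∈ Ioc 0 (σ h)) :
    r 1 ≤ entropyIntegrand B r σ u := by
  have h1 : (1 : ℝ) ≤ massiveness B (modulusInv σ u) := by
    exact_mod_cast one_le_massiveness (hσ.modulusInv_spec hh hu.1 hu.2).1
  exact hr.2.1.monotoneOn self_mem_Ici (mem_Ici.2 h1) h1

end Entropy

/-! ### Decomposition along a chain of nets. -/

section Links

variable {Ω B : Type*}

/-- The link at `u` of a chain through the maps `π k`, starting from the process itself. -/
def chainLink (Y : B → Ω → ℝ) (π : ℕ → B → B) : ℕ → B → Ω → ℝ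
  | 0, u, ω => Y u ω
  | k + 1, u, ω => Y u ω - Y (π k u) ω

lemma abs_le_sum_sup_chainLink (Y : B → Ω → ℝ) {π : ℕ → B → B} {V : ℕ → Finset B}
    (hV : ∀ k, (V k).Nonempty) (hπ : ∀ k u, π k u ∈ V k) (ω : Ω) (m : ℕ) :
    ∀ u ∈ V m, |Y u ω| ≤
      ∑ k ∈ Finset.range (m + 1), (V k).sup' (hV k) fun u => |chainLink Y π k u ω| := by
  induction m with
  | zero =>
    intro u hu
    rw [zero_add, Finset.sum_range_one]
    exact Finset.le_sup' (fun u => |chainLink Y π 0 u ω|) hu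
  | succ m ih =>
    intro u hu
    rw [Finset.sum_range_succ]
    have h1 := ih (π m u) (hπ m u)
    have h2 := Finset.le_sup' (fun u => |chainLink Y π (m + 1) u ω|) hu
    calc |Y u ω| = |Y (π m u) ω + (Y u ω - Y (π m u) ω)| := by ring_nf
      _ ≤ |Y (π m u) ω| + |Y u ω - Y (π m u) ω| := abs_add_le _ _
      _ ≤ _ := add_le_add h1 h2

end Links

/-! ### Exponential moments along the chain and passage to the limit. -/

section Chaining

variable {Ω B : Type*} [MeasurableSpace Ω] {P : Measure Ω} {ζ : ℝ}

lemma lintegral_exp_sup_abs_le {Y : B → Ω → ℝ} {V : Finset B} (hV : V.Nonempty)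
    (hY : ∀ u, Measurable (Y u)) {a : ℝ} (h : ∀ u, ExpBound (phiPow ζ) P (Y u) a) (l : ℝ) :
    ∫⁻ ω, ENNReal.ofReal (Real.exp (l * V.sup' hV fun u => |Y u ω|)) ∂P ≤
      ENNReal.ofReal (2 * V.card * Real.exp (phiPow ζ (a * l))) := by
  have key : ∀ ω, ENNReal.ofReal (Real.exp (l * V.sup' hV fun u => |Y u ω|)) ≤
      ∑ u ∈ V, ENNReal.ofReal (Real.exp (l * |Y u ω|)) := by
    intro ω
    obtain ⟨u, hu, he⟩ := V.exists_mem_eq_sup' hV fun u => |Y u ω|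
    rw [he]
    exact Finset.single_le_sum (f := fun u => ENNReal.ofReal (Real.exp (l * |Y u ω|)))
      (fun _ _ => zero_le) hu
  refine (lintegral_mono key).trans ?_
  rw [lintegral_finsetSum _ fun u _ => by have := hY u; fun_prop]
  refine (Finset.sum_le_sum fun u _ => (h u).lintegral_exp_abs_le (hY u) l).trans (le_of_eq ?_)
  rw [Finset.sum_const, nsmul_eq_mul, mul_comm (2 : ℝ), mul_assoc,
    ENNReal.ofReal_mul (Nat.cast_nonneg _), ENNReal.ofReal_mul two_pos.le,
    ENNReal.ofReal_natCast, ENNReal.ofReal_ofNat]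

/-- A weighted form of Hölder's inequality for exponential moments. -/
lemma lintegral_exp_sum_le_exp_sum [IsProbabilityMeasure P] (s : Finset ℕ) {η : ℕ → Ω → ℝ}
    (hη : ∀ k, Measurable (η k)) {w c : ℕ → ℝ} {v l : ℝ} (hw : ∀ k, 0 < w k) (hv : 0 ≤ v)
    (hsum : v + ∑ k ∈ s, w k = 1)
    (h : ∀ k, ∫⁻ ω, ENNReal.ofReal (Real.exp (l / w k * η k ω)) ∂P ≤
      ENNReal.ofReal (Real.exp (c k))) :
    ∫⁻ ω, ENNReal.ofReal (Real.exp (l * ∑ k ∈ s, η k ω)) ∂P ≤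
      ENNReal.ofReal (Real.exp (∑ k ∈ s, w k * c k)) := by
  set C := Real.exp (∑ k ∈ s, w k * c k) with hC
  have hC0 : 0 < C := Real.exp_pos _
  -- Dividing by `exp (c k)` gives each factor mean at most 1; convexity of `exp` then bounds the
  -- product by a weighted mean, with `v` the weight at 0.
  have key : ∀ ω, ENNReal.ofReal (Real.exp (l * ∑ k ∈ s, η k ω)) ≤
      ENNReal.ofReal C * (∑ k ∈ s, ENNReal.ofReal (w k * Real.exp (-c k)) *
        ENNReal.ofReal (Real.exp (l / w k * η k ω)) + ENNReal.ofReal v) := by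
    intro ω
    have e : l * ∑ k ∈ s, η k ω =
        ∑ k ∈ s, w k * c k + ∑ k ∈ s, w k * (l / w k * η k ω - c k) := by
      rw [← Finset.sum_add_distrib, Finset.mul_sum]
      refine Finset.sum_congr rfl fun k _ => ?_
      have := (hw k).ne'
      field_simp
      ring
    rw [e, Real.exp_add, ENNReal.ofReal_mul hC0.le]
    gcongr
    refine (ENNReal.ofReal_le_ofReal
      (exp_sum_le s (x := fun k => l / w k * η k ω - c k) (fun k => (hw k).le) hv hsum)).trans ?_
    rw [ENNReal.ofReal_add (Finset.sum_nonneg fun k _ => mul_nonneg (hw k).le (Real.exp_pos _).le)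
      hv, ENNReal.ofReal_sum_of_nonneg fun k _ => mul_nonneg (hw k).le (Real.exp_pos _).le]
    gcongr with k
    rw [← ENNReal.ofReal_mul (mul_nonneg (hw k).le (Real.exp_pos _).le), sub_eq_add_neg,
      Real.exp_add]
    refine le_of_eq ?_
    ring_nf
  refine (lintegral_mono key).trans ?_
  rw [lintegral_const_mul' _ _ ENNReal.ofReal_ne_top, lintegral_add_right _ measurable_const,
    lintegral_finsetSum _ fun k _ => by have := hη k; fun_prop]
  simp_rw [lintegral_const_mul' _ _ ENNReal.ofReal_ne_top]
  rw [lintegral_const, measure_univ, mul_one]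
  refine mul_le_of_le_one_right' ?_
  calc ∑ k ∈ s, ENNReal.ofReal (w k * Real.exp (-c k)) *
          ∫⁻ ω, ENNReal.ofReal (Real.exp (l / w k * η k ω)) ∂P + ENNReal.ofReal v
      ≤ ∑ k ∈ s, ENNReal.ofReal (w k * Real.exp (-c k)) * ENNReal.ofReal (Real.exp (c k)) +
          ENNReal.ofReal v := by
        gcongr with k
        exact h k
    _ = ∑ k ∈ s, ENNReal.ofReal (w k) + ENNReal.ofReal v := by
        congr 1
        refine Finset.sum_congr rfl fun k _ => ?_
        rw [← ENNReal.ofReal_mul (mul_nonneg (hw k).le (Real.exp_pos _).le), mul_assoc,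
          ← Real.exp_add, neg_add_cancel, Real.exp_zero, mul_one]
    _ = 1 := by
        rw [← ENNReal.ofReal_sum_of_nonneg fun k _ => (hw k).le,
          ← ENNReal.ofReal_add (Finset.sum_nonneg fun k _ => (hw k).le) hv, add_comm, hsum,
          ENNReal.ofReal_one]

lemma measurable_chainLink {Y : B → Ω → ℝ} (hY : ∀ u, Measurable (Y u)) (π : ℕ → B → B) (k : ℕ)
    (u : B) : Measurable (chainLink Y π k u) := by
  cases k with
  | zero => exact hY u
  | succ k => exact (hY u).sub (hY _)

lemma sum_geometric_weights (p : ℝ) (m : ℕ) :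
    p ^ m + ∑ k ∈ Finset.range m, (1 - p) * p ^ k = 1 := by
  induction m with
  | zero => simp
  | succ m ih =>
    rw [Finset.sum_range_succ]
    linear_combination ih

lemma lintegral_exp_sup_le_of_chain [IsProbabilityMeasure P] (hζ : 0 < ζ) {Y : B → Ω → ℝ}
    (hY : ∀ u, Measurable (Y u)) {π : ℕ → B → B} {V : ℕ → Finset B}
    (hV : ∀ k, (V k).Nonempty) (hπ : ∀ k u, π k u ∈ V k) {γ β p x : ℝ} (hγ : 0 ≤ γ) (hβ : 0 ≤ β)
    (hp : 0 < p) (hp1 : p < 1) (hx : 0 ≤ x) (hYγ : ∀ u, ExpBound (phiPow ζ) P (Y u) γ)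
    (hYβ : ∀ k u, ExpBound (phiPow ζ) P (fun ω => Y u ω - Y (π k u) ω) (β * p ^ (k + 1)))
    (m : ℕ) :
    ∫⁻ ω, ENNReal.ofReal (Real.exp (x * (1 - p) * (V m).sup' (hV m) fun u => |Y u ω|)) ∂P ≤
      ENNReal.ofReal (2 *
        Real.exp (∑ k ∈ Finset.range (m + 1), (1 - p) * p ^ k * Real.log (V k).card) *
        Real.exp ((γ ^ ζ * (1 - p) + p * β ^ ζ) * x ^ ζ / ζ)) := by
  have hp1' : 0 < 1 - p := sub_pos.2 hp1
  set w : ℕ → ℝ := fun k => (1 - p) * p ^ k with hw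
  have hw0 : ∀ k, 0 < w k := fun k => by simp only [hw]; positivity
  -- Since `x (1-p) / w k = x p^(-k)`, the factor `p^k` in the standard of the `k`-th link cancels:
  -- all links after the first have the same exponent.
  set e : ℕ → ℝ := fun k => if k = 0 then (γ * x) ^ ζ / ζ else (β * x) ^ ζ / ζ with he
  set η : ℕ → Ω → ℝ := fun k ω => (V k).sup' (hV k) fun u => |chainLink Y π k u ω| with hη
  have hηm : ∀ k, Measurable (η k) := fun k => by
    have := Finset.measurable_sup' (hV k) (f := fun u ω => |chainLink Y π k u ω|)
      fun u _ => (measurable_chainLink hY π k u).abs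
    convert this using 1
    ext ω
    simp only [hη, Finset.sup'_apply]
  have hlink : ∀ k, ∫⁻ ω, ENNReal.ofReal (Real.exp (x * (1 - p) / w k * η k ω)) ∂P ≤
      ENNReal.ofReal (Real.exp (Real.log (2 * (V k).card) + e k)) := by
    intro k
    have hc : (0 : ℝ) < 2 * (V k).card := by
      have : (0 : ℝ) < (V k).card := by exact_mod_cast (hV k).card_pos
      positivity
    rw [Real.exp_add, Real.exp_log hc]
    cases k with
    | zero =>
      refine (lintegral_exp_sup_abs_le (hV 0) (measurable_chainLink hY π 0)
        (a := γ) hYγ _).trans (le_of_eq ?_)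
      have : x * (1 - p) / w 0 = x := by simp only [hw]; field_simp
      rw [this, phiPow, abs_of_nonneg (mul_nonneg hγ hx)]
      simp [he]
    | succ k =>
      refine (lintegral_exp_sup_abs_le (hV (k + 1)) (measurable_chainLink hY π (k + 1))
        (a := β * p ^ (k + 1)) (hYβ k) _).trans (le_of_eq ?_)
      have : β * p ^ (k + 1) * (x * (1 - p) / w (k + 1)) = β * x := by
        simp only [hw]; field_simp
      rw [this, phiPow, abs_of_nonneg (mul_nonneg hβ hx)]
      simp [he]
  have hsum := sum_geometric_weights p (m + 1)
  have hstep := lintegral_exp_sum_le_exp_sum (Finset.range (m + 1)) hηm hw0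
    (pow_nonneg hp.le (m + 1)) hsum hlink
  have hle : ∀ ω, ENNReal.ofReal
      (Real.exp (x * (1 - p) * (V m).sup' (hV m) fun u => |Y u ω|)) ≤
      ENNReal.ofReal (Real.exp (x * (1 - p) * ∑ k ∈ Finset.range (m + 1), η k ω)) := by
    intro ω
    gcongr
    exact Finset.sup'_le _ _ (abs_le_sum_sup_chainLink Y hV hπ ω m)
  refine (lintegral_mono hle).trans (hstep.trans (ENNReal.ofReal_le_ofReal ?_))
  have hlog2 : (2 : ℝ) = Real.exp (Real.log 2) := (Real.exp_log two_pos).symm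
  nth_rewrite 2 [hlog2]
  rw [← Real.exp_add, ← Real.exp_add]
  refine Real.exp_le_exp.2 ?_
  have hsplit : ∀ k, w k * (Real.log (2 * (V k).card) + e k) =
      w k * Real.log 2 + w k * Real.log (V k).card + w k * e k := by
    intro k
    rw [Real.log_mul two_ne_zero (by exact_mod_cast (hV k).card_pos.ne')]
    ring
  simp_rw [hsplit]
  rw [Finset.sum_add_distrib, Finset.sum_add_distrib, ← Finset.sum_mul]
  have hW : ∑ k ∈ Finset.range (m + 1), w k ≤ 1 := by
    have : 0 ≤ p ^ (m + 1) := by positivity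
    linarith
  -- The weight `1 - p` goes to the initial link, which carries `γ`, and at most `p` is left for the
  -- links carrying `β`.
  have hW' : ∑ k ∈ Finset.range m, w (k + 1) ≤ p := by
    rw [Finset.sum_range_succ'] at hW
    simp only [hw, pow_zero, mul_one] at hW ⊢
    linarith
  refine add_le_add (add_le_add (mul_le_of_le_one_left (Real.log_nonneg one_le_two) hW) le_rfl) ?_
  rw [Finset.sum_range_succ']
  have he1 : ∀ k, e (k + 1) = (β * x) ^ ζ / ζ := fun k => by simp [he]
  have he0 : e 0 = (γ * x) ^ ζ / ζ := by simp [he]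
  have hw00 : w 0 = 1 - p := by simp [hw]
  simp_rw [he1]
  rw [he0, hw00, ← Finset.sum_mul]
  calc (∑ k ∈ Finset.range m, w (k + 1)) * ((β * x) ^ ζ / ζ) + (1 - p) * ((γ * x) ^ ζ / ζ)
      ≤ p * ((β * x) ^ ζ / ζ) + (1 - p) * ((γ * x) ^ ζ / ζ) := by gcongr
    _ = (γ ^ ζ * (1 - p) + p * β ^ ζ) * x ^ ζ / ζ := by
      rw [Real.mul_rpow hβ hx, Real.mul_rpow hγ hx]
      ring

/-- The first moments are summable, so `∑ |Z k|` is finite almost surely. -/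
lemma ae_tendsto_zero_of_expBound {Z : ℕ → Ω → ℝ} (hZ : ∀ k, Measurable (Z k))
    {a : ℕ → ℝ} (ha : ∀ k, 0 < a k) (hsum : Summable a)
    (h : ∀ k, ExpBound (phiPow ζ) P (Z k) (a k)) :
    ∀ᵐ ω ∂P, Tendsto (fun k => Z k ω) atTop (𝓝 0) := by
  have hfin : ∫⁻ ω, ∑' k, ENNReal.ofReal |Z k ω| ∂P ≠ ⊤ := by
    rw [lintegral_tsum fun k => by have := hZ k; fun_prop]
    refine ne_top_of_le_ne_top ?_ (ENNReal.tsum_le_tsum fun k =>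
      (h k).lintegral_abs_le (hZ k) (ha k))
    rw [← ENNReal.ofReal_tsum_of_nonneg (fun k => by have := ha k; positivity)
      (hsum.mul_left _)]
    exact ENNReal.ofReal_ne_top
  have hm : Measurable fun ω => ∑' k, ENNReal.ofReal |Z k ω| :=
    Measurable.tsum fun k => by have := hZ k; fun_prop
  filter_upwards [ae_lt_top hm hfin] with ω hω
  have := ENNReal.tendsto_atTop_zero_of_tsum_ne_top hω.ne
  rw [tendsto_zero_iff_abs_tendsto_zero]
  have h2 := (ENNReal.tendsto_toReal ENNReal.zero_ne_top).comp this
  simpa [Function.comp_def] using h2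

/-- The nets need not be nested or contain `S`: almost surely `Y (π k s) → Y s` for all `s ∈ S`, so
an exceedance at `s` shows up on all late nets. Fatou and Markov then apply to the lower limit. -/
lemma measure_exists_abs_gt_le_of_chain {Y : B → Ω → ℝ} (hY : ∀ u, Measurable (Y u))
    {π : ℕ → B → B} {V : ℕ → Finset B} (hV : ∀ k, (V k).Nonempty) (hπ : ∀ k u, π k u ∈ V k)
    {b : ℕ → ℝ} (hb : ∀ k, 0 < b k) (hsum : Summable b)
    (hYb : ∀ k u, ExpBound (phiPow ζ) P (fun ω => Y u ω - Y (π k u) ω) (b k))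
    {S : Set B} (hS : S.Countable) {l A : ℝ} (hl : 0 ≤ l)
    (hmom : ∀ m, ∫⁻ ω, ENNReal.ofReal (Real.exp (l * (V m).sup' (hV m) fun u => |Y u ω|)) ∂P ≤
      ENNReal.ofReal A) (δ : ℝ) :
    P {ω | ∃ s ∈ S, δ < |Y s ω|} ≤ ENNReal.ofReal (A * Real.exp (-(l * δ))) := by
  set g : ℕ → Ω → ENNReal := fun m ω =>
    ENNReal.ofReal (Real.exp (l * (V m).sup' (hV m) fun u => |Y u ω|)) with hg
  have hgm : ∀ m, Measurable (g m) := fun m => by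
    have h1 := Finset.measurable_sup' (hV m) (f := fun u ω => |Y u ω|) fun u _ => (hY u).abs
    have h2 : (fun ω => (V m).sup' (hV m) fun u => |Y u ω|) =
        (V m).sup' (hV m) fun u ω => |Y u ω| := by
      ext ω
      simp only [Finset.sup'_apply]
    rw [← h2] at h1
    exact (Real.measurable_exp.comp (h1.const_mul l)).ennreal_ofReal
  have hlim : ∀ᵐ ω ∂P, ∀ s ∈ S, Tendsto (fun k => Y (π k s) ω) atTop (𝓝 (Y s ω)) := by
    refine (ae_ball_iff hS).2 fun s _ => ?_
    filter_upwards [ae_tendsto_zero_of_expBound (fun k => (hY s).sub (hY (π k s))) hb hsum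
      fun k => hYb k s] with ω hω
    simpa using hω.const_sub (Y s ω)
  have hmono : P {ω | ∃ s ∈ S, δ < |Y s ω|} ≤
      P {ω | ENNReal.ofReal (Real.exp (l * δ)) ≤ liminf (fun m => g m ω) atTop} := by
    refine measure_mono_ae ?_
    filter_upwards [hlim] with ω hω
    rintro ⟨s, hs, hδ⟩
    refine le_liminf_of_le (by isBoundedDefault) ?_
    filter_upwards [(hω s hs).abs.eventually_const_lt hδ] with m hm
    refine ENNReal.ofReal_le_ofReal (Real.exp_le_exp.2 (mul_le_mul_of_nonneg_left ?_ hl))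
    exact hm.le.trans (Finset.le_sup' (fun u => |Y u ω|) (hπ m s))
  have hint : ∫⁻ ω, liminf (fun m => g m ω) atTop ∂P ≤ ENNReal.ofReal A :=
    lintegral_le_of_ae_le_liminf hgm (ae_of_all _ fun _ => le_rfl) (Eventually.of_forall hmom)
  refine hmono.trans ((meas_ge_le_lintegral_div (Measurable.liminf hgm).aemeasurable
    (by simpa using Real.exp_pos _) ENNReal.ofReal_ne_top).trans ?_)
  rw [Real.exp_neg, ← div_eq_mul_inv, ENNReal.ofReal_div_of_pos (Real.exp_pos _)]
  gcongr

/-- `x = (D / M)^(1/(ζ-1))` minimises `M x^ζ / ζ - x D`; this is the exponent left by Markov's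
inequality. -/
lemma young_optimal (hζ : 1 < ζ) {D M : ℝ} (hD : 0 < D) (hM : 0 < M) :
    M * ((D / M) ^ (1 / (ζ - 1))) ^ ζ / ζ - (D / M) ^ (1 / (ζ - 1)) * D =
      -((ζ - 1) * D ^ (ζ / (ζ - 1)) / (ζ * M ^ (1 / (ζ - 1)))) := by
  have hζ' : ζ - 1 ≠ 0 := by linarith
  have hζ0 : ζ ≠ 0 := by linarith
  set x := (D / M) ^ (1 / (ζ - 1)) with hx
  have hx0 : 0 < x := by positivity
  have h1 : x ^ ζ = x * (D / M) := by
    have : x ^ (ζ - 1) = D / M := by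
      rw [hx, ← Real.rpow_mul (by positivity), one_div_mul_cancel hζ', Real.rpow_one]
    rw [← this, Real.rpow_sub_one hx0.ne']
    field_simp
  have h2 : D ^ (ζ / (ζ - 1)) = D ^ (1 / (ζ - 1)) * D := by
    have : ζ / (ζ - 1) = 1 / (ζ - 1) + 1 := by field_simp; ring
    rw [this, Real.rpow_add_one hD.ne']
  have h3 : x = D ^ (1 / (ζ - 1)) / M ^ (1 / (ζ - 1)) := Real.div_rpow hD.le hM.le _
  have hM' : M ^ (1 / (ζ - 1)) ≠ 0 := (Real.rpow_pos_of_pos hM _).ne'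
  rw [h1, h2, h3]
  field_simp
  ring

end Chaining

/-! ### The entropy tail bound on a countable set. -/

section EntropyBound

variable {Ω B : Type*} [MeasurableSpace Ω] {P : Measure Ω} [IsProbabilityMeasure P] {ζ : ℝ}
  [MetricSpace B] [CompactSpace B] [Nonempty B]

lemma measure_exists_abs_gt_le_entropy (hζ : 1 < ζ) {Y : B → Ω → ℝ}
    (hY : ∀ t, IsPhiSubGaussian (phiPow ζ) P (Y t)) {σ : ℝ → ℝ} (hσ : IsModulus σ)
    (hYσ : IncrementsBoundedBy (phiPow ζ) P Y σ) {r : ℝ → ℝ} (hr : IsEntropyGauge r)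
    {h : ℝ} (hh : 0 < h) (hint : IntegrableOn (entropyIntegrand B r σ) (Ioc 0 (σ h)))
    {γ : ℝ} (hγ : ∀ u, tauPhi (phiPow ζ) P (Y u) ≤ γ) {S : Set B} (hS : S.Countable)
    {p δ : ℝ} (hp : 0 < p) (hp1 : p < 1) (hδ : 0 < δ) :
    P {ω | ∃ s ∈ S, δ < |Y s ω|} ≤ ENNReal.ofReal
      (2 * Real.exp (-((ζ - 1) * (δ * (1 - p)) ^ (ζ / (ζ - 1)) /
            (ζ * (γ ^ ζ * (1 - p) + p * σ h ^ ζ) ^ (1 / (ζ - 1))))) *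
          gaugeInv r (1 / (σ h * p) * ∫ u in (0 : ℝ)..(σ h * p), entropyIntegrand B r σ u)) := by
  have hζ0 : 0 < ζ := by linarith
  set β := σ h with hβdef
  have hβ : 0 < β := hσ.pos hh
  have hγ0 : 0 ≤ γ := (tauPhi_nonneg _ _ _).trans (hγ (Classical.arbitrary B))
  have hp1' : 0 < 1 - p := sub_pos.2 hp1
  have hβk : ∀ k : ℕ, 0 < β * p ^ k := fun k => by positivity
  have hβk' : ∀ k : ℕ, β * p ^ k ≤ β := fun k =>
    mul_le_of_le_one_right hβ.le (pow_le_one₀ hp.le hp1.le)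
  -- The shift `k + 1` makes even the coarsest net have scale `β p`, so the samples `β p · p^k` lie
  -- in `(0, β p]`, the range of the integral.
  set ε : ℕ → ℝ := fun k => modulusInv σ (β * p ^ (k + 1)) with hε
  have hεs : ∀ k, 0 < ε k ∧ σ (ε k) = β * p ^ (k + 1) := fun k =>
    hσ.modulusInv_spec hh (hβk _) (hβk' _)
  choose V hVcard hVcov using fun k => exists_finset_card_eq_massiveness (B := B) (hεs k).1
  choose π hπ hπd using hVcov
  have hV : ∀ k, (V k).Nonempty := fun k => ⟨_, hπ k (Classical.arbitrary B)⟩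
  have hlink : ∀ k u,
      ExpBound (phiPow ζ) P (fun ω => Y u ω - Y (π k u) ω) (β * p ^ (k + 1)) := fun k u =>
    ((hY u).sub hζ0 (hY _)).expBound hζ0
      ((hYσ (ε k) (hεs k).1 u (π k u) (hπd k u)).trans_eq (hεs k).2)
  set I := 1 / (β * p) * ∫ u in (0 : ℝ)..(β * p), entropyIntegrand B r σ u with hI
  have hbp : 0 < β * p := by positivity
  have hbp' : β * p ≤ β := mul_le_of_le_one_right hβ.le hp1.le
  have hn : ∀ k, (1 : ℝ) ≤ (V k).card := fun k => by exact_mod_cast (hV k).card_pos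
  have hgauge : ∀ m, Real.exp (∑ k ∈ Finset.range (m + 1),
      (1 - p) * p ^ k * Real.log (V k).card) ≤ gaugeInv r I := by
    intro m
    have hwn : ∀ k : ℕ, 0 ≤ (1 - p) * p ^ k := fun k => by positivity
    refine hr.le_gaugeInv (Real.one_le_exp (Finset.sum_nonneg fun k _ =>
      mul_nonneg (hwn k) (Real.log_nonneg (hn k)))) ?_
    refine (hr.map_exp_sum_log_le _ (n := fun k => ((V k).card : ℝ)) hwn
      (pow_nonneg hp.le (m + 1)) (sum_geometric_weights p (m + 1)) hn).trans ?_
    have := AntitoneOn.sum_geometric_le_integral hbp hp hp1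
      ((entropyIntegrand_antitoneOn (B := B) hr hσ hh).mono (Ioc_subset_Ioc_right hbp'))
      (hint.mono_set (Ioc_subset_Ioc_right hbp'))
      (fun u hu => le_entropyIntegrand hr hσ hh ⟨hu.1, hu.2.trans hbp'⟩) (m + 1)
    rw [hI, one_div_mul_eq_div, le_div_iff₀' hbp]
    refine le_trans (le_of_eq ?_) this
    congr 2
    refine Finset.sum_congr rfl fun k _ => ?_
    rw [entropyIntegrand, hVcard]
    simp only [hε]
    rw [show β * p * p ^ k = β * p ^ (k + 1) by ring]
  set M := γ ^ ζ * (1 - p) + p * β ^ ζ with hM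
  have hM0 : 0 < M := by
    have h1 : 0 ≤ γ ^ ζ := Real.rpow_nonneg hγ0 _
    have h2 : 0 < β ^ ζ := Real.rpow_pos_of_pos hβ _
    positivity
  have hD : 0 < δ * (1 - p) := by positivity
  set x := (δ * (1 - p) / M) ^ (1 / (ζ - 1)) with hx
  have hx0 : 0 < x := by positivity
  have hG : 0 ≤ gaugeInv r I := (Real.exp_pos _).le.trans (hgauge 0)
  have hmom : ∀ m, ∫⁻ ω, ENNReal.ofReal
      (Real.exp (x * (1 - p) * (V m).sup' (hV m) fun u => |Y u ω|)) ∂P ≤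
      ENNReal.ofReal (2 * gaugeInv r I * Real.exp (M * x ^ ζ / ζ)) := by
    intro m
    refine (lintegral_exp_sup_le_of_chain hζ0 (fun u => (hY u).1) hV hπ hγ0 hβ.le hp hp1 hx0.le
      (fun u => (hY u).expBound hζ0 (hγ u)) hlink m).trans (ENNReal.ofReal_le_ofReal ?_)
    gcongr
    exact hgauge m
  have hsum : Summable fun k : ℕ => β * p ^ (k + 1) :=
    ((summable_nat_add_iff 1).2 (summable_geometric_of_lt_one hp.le hp1)).mul_left β
  refine (measure_exists_abs_gt_le_of_chain (fun u => (hY u).1) hV hπ (fun k => hβk (k + 1))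
    hsum hlink hS (by positivity) hmom δ).trans (le_of_eq ?_)
  congr 1
  rw [mul_assoc, ← Real.exp_add, ← young_optimal hζ hD hM0, ← hx, mul_right_comm, sub_eq_add_neg]
  congr 4
  ring

end EntropyBound

/-- Every point is within the diameter of a fixed `u₀`, and standards obey the triangle inequality.
Boundedness makes the real `⨆` a genuine supremum and not the default 0. -/
lemma IncrementsBoundedBy.bddAbove {Ω B : Type*} [MeasurableSpace Ω] [MetricSpace B]
    [CompactSpace B] {P : Measure Ω} {ζ : ℝ} (hζ : 0 < ζ) {Y : B → Ω → ℝ} {σ : ℝ → ℝ}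
    (hYσ : IncrementsBoundedBy (phiPow ζ) P Y σ) (hY : ∀ t, IsPhiSubGaussian (phiPow ζ) P (Y t)) :
    BddAbove (range fun u : B => tauPhi (phiPow ζ) P (Y u)) := by
  rcases isEmpty_or_nonempty B with hB | ⟨⟨u₀⟩⟩
  · simp [range_eq_empty]
  set D := Metric.diam (univ : Set B) + 1 with hD
  have hD0 : 0 < D := by have := Metric.diam_nonneg (s := (univ : Set B)); linarith
  refine ⟨σ D + tauPhi (phiPow ζ) P (Y u₀), ?_⟩
  rintro _ ⟨u, rfl⟩
  have hd : dist u u₀ ≤ D := by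
    have := Metric.dist_le_diam_of_mem isCompact_univ.isBounded (mem_univ u) (mem_univ u₀)
    linarith
  have hinc := ((hY u).sub hζ (hY u₀)).expBound hζ (hYσ D hD0 u u₀ hd)
  have hσ0 : 0 ≤ σ D := (tauPhi_nonneg _ _ _).trans (hYσ D hD0 u u₀ hd)
  have hadd : ExpBound (phiPow ζ) P (fun ω => Y u ω - Y u₀ ω + Y u₀ ω)
      (σ D + tauPhi (phiPow ζ) P (Y u₀)) :=
    hinc.add hζ ((hY u).1.sub (hY u₀).1) hσ0 (tauPhi_nonneg _ _ _) ((hY u₀).expBound_tauPhi hζ)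
  simp_rw [sub_add_cancel] at hadd
  exact tauPhi_le (add_nonneg hσ0 (tauPhi_nonneg _ _ _)) hadd

theorem theorem10 {Ω B : Type*} [MeasurableSpace Ω] (P : Measure Ω) [IsProbabilityMeasure P]
    [MetricSpace B] [CompactSpace B] [Nontrivial B]
    (ζ : ℝ) (hζ1 : 1 < ζ) (hζ2 : ζ ≤ 2)
    -- the process, its series expansion with independent elements, and the model
    (X : B → Ω → ℝ) (ξ : ℕ → Ω → ℝ) (a aHat : ℕ → B → ℝ) (N : ℕ)
    (hX : ∀ t, IsPhiSubGaussian (phiPow ζ) P (X t))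
    (hXsep : IsSeparableProcess P X)
    (hξ : ∀ k, IsPhiSubGaussian (phiPow ζ) P (ξ k))
    (hξind : iIndepFun ξ P)
    (hseries : IsMeanSquareSeries P X ξ a)
    (σ : ℝ → ℝ) (hσ : IsModulus σ) (hXσ : IncrementsBoundedBy (phiPow ζ) P X σ)
    -- the error process `Δ_N = X - X_N` and its modulus
    (Δ : B → Ω → ℝ) (hΔ : ∀ t ω, Δ t ω = X t ω - model ξ aHat N t ω)
    (σN : ℝ → ℝ) (hσN : IsModulus σN) (hΔσ : IncrementsBoundedBy (phiPow ζ) P Δ σN)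
    (β : ℝ) (hβ : β = σN (chebyshevRadius B))
    (r : ℝ → ℝ) (hr : IsEntropyGauge r)
    (hint : IntegrableOn (entropyIntegrand B r σN) (Ioc 0 β))
    (γ : ℝ) (hγ : γ = ⨆ u : B, tauPhi (phiPow ζ) P (Δ u)) :
    BddAbove (range fun u : B => tauPhi (phiPow ζ) P (Δ u)) ∧
    ENNReal.ofReal (γ ^ ζ) ≤
      ∑ k ∈ Finset.range N, ENNReal.ofReal (tauPhi (phiPow ζ) P (ξ k) ^ ζ) *
          (⨆ u : B, ENNReal.ofReal (|a k u - aHat k u| ^ ζ)) +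
        ∑' k : ℕ, ENNReal.ofReal (tauPhi (phiPow ζ) P (ξ (N + k)) ^ ζ) *
          (⨆ u : B, ENNReal.ofReal (|a (N + k) u| ^ ζ)) ∧
    ∀ p δ ν : ℝ, 0 < p → p < 1 → 0 < δ →
      2 * Real.exp (-((ζ - 1) * (δ * (1 - p)) ^ (ζ / (ζ - 1)) /
            (ζ * (γ ^ ζ * (1 - p) + p * β ^ ζ) ^ (1 / (ζ - 1))))) *
          gaugeInv r (1 / (β * p) * ∫ u in (0 : ℝ)..(β * p), entropyIntegrand B r σN u) ≤ ν →
      ApproximatesWith P X (model ξ aHat N) ν δ := by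
  have hζ0 : 0 < ζ := by linarith
  have hmodel : ∀ t, IsPhiSubGaussian (phiPow ζ) P (model ξ aHat N t) := fun t =>
    IsPhiSubGaussian.sum hζ0 _ fun k => (hξ k).const_mul (aHat k t)
  have hΔeq : ∀ t, Δ t = fun ω => X t ω - model ξ aHat N t ω := fun t => funext (hΔ t)
  have hΔsub : ∀ t, IsPhiSubGaussian (phiPow ζ) P (Δ t) := fun t => by
    rw [hΔeq t]
    exact (hX t).sub hζ0 (hmodel t)
  have hbdd : BddAbove (range fun u : B => tauPhi (phiPow ζ) P (Δ u)) := hΔσ.bddAbove hζ0 hΔsub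
  refine ⟨hbdd, ?_, fun p δ ν hp hp1 hδ hν => ?_⟩
  · rw [hγ]
    refine ofReal_ciSup_rpow_le hζ0 (fun u => tauPhi_nonneg _ _ _) fun u => ?_
    rw [hΔeq u]
    exact ofReal_tauPhi_error_rpow_le hζ0 hξ hξind (fun t => (hX t).1) hseries aHat N u
  -- The model is `X - Δ`, so it inherits a modulus from both processes.
  · have hinc : IncrementsBoundedBy (phiPow ζ) P (model ξ aHat N) (fun h => σ h + σN h) := by
      intro h hh t s hts
      have e : (fun ω => model ξ aHat N t ω - model ξ aHat N s ω) =
          fun ω => (X t ω - X s ω) - (Δ t ω - Δ s ω) := by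
        ext ω
        rw [hΔ, hΔ]
        ring
      rw [e]
      exact (tauPhi_sub_le hζ0 ((hX t).sub hζ0 (hX s)) ((hΔsub t).sub hζ0 (hΔsub s))).trans
        (add_le_add (hXσ h hh t s hts) (hΔσ h hh t s hts))
    have hw : Tendsto (fun h => σ h + σN h) (𝓝[>] 0) (𝓝 0) := by
      simpa using hσ.2.2.add hσN.2.2
    obtain ⟨S, hS, hsep⟩ := hXsep.sub_continuous (ae_continuous_model hζ1 hξ hξind hw hinc)
    have hγle : ∀ u, tauPhi (phiPow ζ) P (Δ u) ≤ γ := fun u => hγ ▸ le_ciSup hbdd u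
    rw [hβ] at hint hν
    have hbound := (measure_exists_abs_gt_le_entropy hζ1 hΔsub hσN hΔσ hr chebyshevRadius_pos hint
      hγle hS hp hp1 hδ).trans (ENNReal.ofReal_le_ofReal hν)
    refine le_trans (measure_mono_ae ?_) hbound
    filter_upwards [hsep] with ω hω hsup
    obtain ⟨t, ht⟩ := lt_iSup_iff.1 hsup
    obtain ⟨s, hs, hδs⟩ := hω δ t (ENNReal.ofReal_lt_ofReal_iff'.1 ht).1
    exact ⟨s, hs, by rwa [hΔ]⟩
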